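/- **Setting.** Let $n,N,N_y$ be the number of agents, of parameters and of outputs per agent. For $t\ge 0$ let $\mathcal G(t)$ be an undirected graph on $\{1,\dots,n\}$ with $n_e(t)$ edges and an arbitrary orientation, $D(t)\in\mathbb R^{n\times n_e(t)}$ its oriented incidence matrix (entry $+1$ at the source of an edge, $-1$ at its sink, $0$ otherwise), and $L(t)=D(t)D(t)^\top$ its Laplacian. Let $C_i(t)\in\mathbb R^{N_y\times N}$ be the local regressors, $\alpha\in\mathbb{R}$ the consensus gain, $\Gamma_i\in\mathbb R^{N\times N}$ the gradient gains, $\bar\Gamma=\mathrm{diag}(\Gamma_1,\dots,\Gamma_n)$, $\bar C(t)=\mathrm{diag}(C_1(t),\dots,C_n(t))$ and $\bar\Lambda(t)=\begin{bmatrix}\bar C(t)\\ \sqrt\alpha\,D(t)^\top\otimes I_N\end{bmatrix}$. The entries of $C_i(\cdot)$ and $L(\cdot)$ are measurable on $[0,\infty)$. The error system is $$\dot{\tilde x}(t)=-\bar\Gamma\,\bar\Lambda(t)^\top\bar\Lambda(t)\,\tilde x(t),\qquad \tilde x(t)\in\mathbb R^{nN},$$ its trajectories being understood in the sense of Carathéodory.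 $\|\cdot\|$ is the Euclidean norm of vectors and the induced norm of matrices. **Assumptions.** (A1) Every $\Gamma_i$ is symmetric positive definite, and $\alpha>0$. (A2) There are positive constants $T$, $\bar\iota_1\ge\underline\iota_1$, $r_2$, $\underline\lambda$, $r_3$ such that 1. $\bar\iota_1 I_N\ge\int_{t-T}^t\sum_{i=1}^n C_i(s)^\top C_i(s)\,\mathrm ds\ge\underline\iota_1 I_N$ for all $t\ge T$; 2. $\|C_i(t)^\top C_i(t)\|\le r_2$ for all $t\ge0$ and all $i$; 3. for all $t\ge T$, zero is a simple eigenvalue of $\int_{t-T}^tL(s)\,\mathrm ds$ and all its other eigenvalues are at least $\underline\lambda$; and $\|L(t)\|\le r_3$ for all $t\ge 0$. **Constants.** Put $r_1=\|\bar\Gamma\|$, $\bar\iota_2=T(r_2+\alpha r_3)$, $$\underline\iota_2=\min_{a\in\mathbb R^N,\ \|a\|^2\le1}\max\Big\{\alpha\underline\lambda(1-\|a\|^2),\ \tfrac{\underline\iota_1}{n}\|a\|^2-2r_2T\sqrt{\|a\|^2(1-\|a\|^2)}\Big\},$$ $\varphi_1=\tfrac12r_1^2\bar\iota_2^2$, $\varphi_2=\tfrac14(\mathrm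 e^{2r_1\bar\iota_2}-1)-\tfrac12r_1\bar\iota_2$, $$\bar\iota_3=\Big(\sqrt{\bar\iota_2-\underline\iota_2+\varphi_2\underline\iota_2}+\sqrt{\bar\iota_2}\Big)^2,\qquad \underline\iota_3=\begin{cases}\Big(\dfrac{\sqrt{\bar\iota_2-\underline\iota_2+\varphi_1\underline\iota_2}-\sqrt{\bar\iota_2}}{\varphi_1-1}\Big)^2&\text{if }\varphi_1\ne1,\\[2mm] \dfrac{\underline\iota_2^2}{4\bar\iota_2}&\text{if }\varphi_1=1,\end{cases}$$ $$\kappa_1=\tfrac T2\lambda_{\max}(\bar\Gamma^{-1})+T\bar\iota_3,\qquad \kappa_2=\tfrac T2\lambda_{\min}(\bar\Gamma^{-1}).$$ **Claim.** Under (A1) and (A2), for every $t_0\ge0$, every trajectory $\tilde x$ of the error system on $[t_0,\infty)$ satisfies, for all $t\ge t_0$, $$\|\tilde x(t)\|\le\sqrt{\frac{\kappa_1}{\kappa_2}}\;\|\tilde x(t_0)\|\;\mathrm e^{-\frac{\underline\iota_3}{2\kappa_1}(t-t_0)}.$$ -/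

import Mathlib

namespace CIEstimator

open MeasureTheory

/-- The block-diagonal matrix `diag(B₁, …, Bₙ)`: row `(i, k)`, column `(j, l)`, where the first index
is the block (the agent) and the second one is the position inside the block. -/
def blockDiag {n p q : ℕ} (B : Fin n → Matrix (Fin p) (Fin q) ℝ) :
    Matrix (Fin n × Fin p) (Fin n × Fin q) ℝ :=
  Matrix.of fun r c => if r.1 = c.1 then B r.1 r.2 c.2 else 0

/-- The matrix norm induced by the Euclidean norm. -/
noncomputable def inducedNorm {m : Type*} [Fintype m] [DecidableEq m] (A : Matrix m m ℝ) : ℝ :=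
  ‖Matrix.toEuclideanCLM (n := m) (𝕜 := ℝ) A‖

/-- The largest eigenvalue (of a symmetric matrix). -/
noncomputable def lambdaMax {m : Type*} [Fintype m] [DecidableEq m] (A : Matrix m m ℝ) : ℝ :=
  sSup (spectrum ℝ A)

/-- The smallest eigenvalue (of a symmetric matrix). -/
noncomputable def lambdaMin {m : Type*} [Fintype m] [DecidableEq m] (A : Matrix m m ℝ) : ℝ :=
  sInf (spectrum ℝ A)

/-- The entrywise integral `∫_a^b A(s) ds` of a matrix-valued function. -/
noncomputable def matIntegral {m q : Type*} (A : ℝ → Matrix m q ℝ) (a b : ℝ) : Matrix m q ℝ :=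
  Matrix.of fun i j => ∫ s in a..b, A s i j

/-- Every entry of the matrix-valued function `A` is Lebesgue measurable on `[0, ∞)`. -/
def MeasurableEntries {m q : Type*} (A : ℝ → Matrix m q ℝ) : Prop :=
  ∀ i j, AEMeasurable (fun t => A t i j) (volume.restrict (Set.Ici 0))

/-- An orientation of an undirected graph: each edge gets a source and a sink. -/
structure EdgeOrientation {n : ℕ} (G : SimpleGraph (Fin n)) where
  /-- the source of an edge -/
  source : G.edgeSet → Fin n
  /-- the sink of an edge -/
  sink : G.edgeSet → Fin n
  /-- the source and the sink are the two end points of the edge -/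
  ends : ∀ e : G.edgeSet, s(source e, sink e) = (e : Sym2 (Fin n))

/-- The oriented incidence matrix `D`, with one row per node and one column per edge. -/
def incidence {n : ℕ} {G : SimpleGraph (Fin n)} (o : EdgeOrientation G) :
    Matrix (Fin n) G.edgeSet ℝ :=
  Matrix.of fun i e => if i = o.source e then 1 else if i = o.sink e then -1 else 0

noncomputable instance edgeFintype {n : ℕ} (G : SimpleGraph (Fin n)) : Fintype G.edgeSet :=
  Fintype.ofFinite _

/-- The graph Laplacian `L = D Dᵀ`. -/
noncomputable def laplacian {n : ℕ} {G : SimpleGraph (Fin n)} (o : EdgeOrientation G) :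
    Matrix (Fin n) (Fin n) ℝ :=
  incidence o * (incidence o).transpose

/-- The network regressor `Λ̄`, which stacks `C̄ = diag(C₁, …, Cₙ)` on top of `√α (Dᵀ ⊗ I_N)`. -/
noncomputable def regressor {n N Ny : ℕ} (C : Fin n → Matrix (Fin Ny) (Fin N) ℝ)
    {G : SimpleGraph (Fin n)} (o : EdgeOrientation G) (α : ℝ) :
    Matrix ((Fin n × Fin Ny) ⊕ (G.edgeSet × Fin N)) (Fin n × Fin N) ℝ :=
  Matrix.fromRows (blockDiag C)
    (Real.sqrt α • Matrix.kronecker (incidence o).transpose (1 : Matrix (Fin N) (Fin N) ℝ))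

/-- `x` is a trajectory on `[t₀, ∞)` of the error system `x' = -Γ̄ Λ̄(t)ᵀ Λ̄(t) x`, in the sense of
Carathéodory: `x` is continuous and satisfies the integrated equation (the right-hand side may be
discontinuous in time because the graph switches). -/
def IsErrorTrajectory {n N Ny : ℕ} (C : ℝ → Fin n → Matrix (Fin Ny) (Fin N) ℝ)
    (G : ℝ → SimpleGraph (Fin n)) (o : (t : ℝ) → EdgeOrientation (G t))
    (Γ : Fin n → Matrix (Fin N) (Fin N) ℝ) (α t₀ : ℝ)
    (x : ℝ → EuclideanSpace ℝ (Fin n × Fin N)) : Prop :=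
  ContinuousOn x (Set.Ici t₀) ∧
    ∀ t, t₀ ≤ t → ∀ k, x t k = x t₀ k + ∫ s in t₀..t,
      (-(blockDiag Γ * (regressor (C s) (o s) α).transpose * regressor (C s) (o s) α)).mulVec
        (x s).ofLp k

/-- The assumption on the gains of the algorithm. -/
structure GainAssumption {n N : ℕ} (Γ : Fin n → Matrix (Fin N) (Fin N) ℝ) (α : ℝ) : Prop where
  posDef : ∀ i, (Γ i).PosDef
  alpha_pos : 0 < α

/-- The assumptions on the regressors and on the communication graph, with their constants: window
`T`, excitation bounds `i1lo ≤ i1hi`, regressor bound `r2`, bound `lam` for the nonzero eigenvalues of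
the integrated Laplacian, and Laplacian bound `r3`. -/
structure NetworkAssumption {n N Ny : ℕ} (C : ℝ → Fin n → Matrix (Fin Ny) (Fin N) ℝ)
    (G : ℝ → SimpleGraph (Fin n)) (o : (t : ℝ) → EdgeOrientation (G t))
    (T i1lo i1hi r2 lam r3 : ℝ) : Prop where
  measurable_regressor : ∀ i, MeasurableEntries fun t => C t i
  measurable_laplacian : MeasurableEntries fun t => laplacian (o t)
  T_pos : 0 < T
  i1lo_pos : 0 < i1lo
  i1lo_le : i1lo ≤ i1hi
  r2_pos : 0 < r2
  lam_pos : 0 < lam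
  r3_pos : 0 < r3
  /-- cooperative persistent excitation, upper bound -/
  excitation_le : ∀ t, T ≤ t →
    (i1hi • (1 : Matrix (Fin N) (Fin N) ℝ) -
      matIntegral (fun s => ∑ i, (C s i).transpose * C s i) (t - T) t).PosSemidef
  /-- cooperative persistent excitation, lower bound -/
  le_excitation : ∀ t, T ≤ t →
    (matIntegral (fun s => ∑ i, (C s i).transpose * C s i) (t - T) t -
      i1lo • (1 : Matrix (Fin N) (Fin N) ℝ)).PosSemidef
  /-- the local regressors are uniformly bounded -/
  regressor_bound : ∀ t, 0 ≤ t → ∀ i, inducedNorm ((C t i).transpose * C t i) ≤ r2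
  /-- connectedness on average: zero is a simple eigenvalue of the integrated Laplacian … -/
  zero_simple : ∀ t, T ≤ t →
    (matIntegral (fun s => laplacian (o s)) (t - T) t).charpoly.rootMultiplicity 0 = 1
  /-- … and all its other eigenvalues are at least `lam` -/
  lam_le : ∀ t, T ≤ t →
    ∀ μ ∈ spectrum ℝ (matIntegral (fun s => laplacian (o s)) (t - T) t), μ ≠ 0 → lam ≤ μ
  /-- the Laplacian is uniformly bounded -/
  laplacian_bound : ∀ t, 0 ≤ t → inducedNorm (laplacian (o t)) ≤ r3

/-- `ῑ₂ = T r₄` with `r₄ = r₂ + α r₃`. -/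
def iota2Upper (T α r2 r3 : ℝ) : ℝ := T * (r2 + α * r3)

/-- `ι̲₂ = min_{a ∈ ℝᴺ, ‖a‖² ≤ 1} max {α λ̲ (1 - ‖a‖²), (ι̲₁ / n) ‖a‖² - 2 r₂ T √(‖a‖² (1 - ‖a‖²))}`. -/
noncomputable def iota2Lower (n N : ℕ) (T α i1lo r2 lam : ℝ) : ℝ :=
  sInf ((fun a : EuclideanSpace ℝ (Fin N) =>
    max (α * lam * (1 - ‖a‖ ^ 2))
      (i1lo / n * ‖a‖ ^ 2 - 2 * r2 * T * Real.sqrt (‖a‖ ^ 2 * (1 - ‖a‖ ^ 2)))) '' {a | ‖a‖ ^ 2 ≤ 1})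

/-- `φ₁ = r₁² ῑ₂² / 2`, as a function of `r₁` and `b = ῑ₂`. -/
noncomputable def phi1 (r1 b : ℝ) : ℝ := 1 / 2 * r1 ^ 2 * b ^ 2

/-- `φ₂ = (exp (2 r₁ ῑ₂) - 1) / 4 - r₁ ῑ₂ / 2`, as a function of `r₁` and `b = ῑ₂`. -/
noncomputable def phi2 (r1 b : ℝ) : ℝ := 1 / 4 * (Real.exp (2 * r1 * b) - 1) - 1 / 2 * r1 * b

/-- `ῑ₃` as a function of `r₁`, `a = ι̲₂` and `b = ῑ₂`. -/
noncomputable def iota3Upper (r1 a b : ℝ) : ℝ :=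
  (Real.sqrt (b - a + phi2 r1 b * a) + Real.sqrt b) ^ 2

open Classical in
/-- `ι̲₃` as a function of `r₁`, `a = ι̲₂` and `b = ῑ₂`. The value for `φ₁ = 1` is the limit of the
other formula. -/
noncomputable def iota3Lower (r1 a b : ℝ) : ℝ :=
  if phi1 r1 b = 1 then a ^ 2 / (4 * b)
  else ((Real.sqrt (b - a + phi1 r1 b * a) - Real.sqrt b) / (phi1 r1 b - 1)) ^ 2

/-- `κ₁ = (T / 2) λ_max(Γ̄⁻¹) + T ῑ₃`. -/
noncomputable def kappa1 {n N : ℕ} (T : ℝ) (Γ : Fin n → Matrix (Fin N) (Fin N) ℝ) (i3hi : ℝ) : ℝ :=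
  T / 2 * lambdaMax (blockDiag Γ)⁻¹ + T * i3hi

/-- `κ₂ = (T / 2) λ_min(Γ̄⁻¹)`. -/
noncomputable def kappa2 {n N : ℕ} (T : ℝ) (Γ : Fin n → Matrix (Fin N) (Fin N) ℝ) : ℝ :=
  T / 2 * lambdaMin (blockDiag Γ)⁻¹

end CIEstimator

/-! Write `M = Λ̄ᵀΛ̄`, `P = Γ̄⁻¹` and `W = ⟪P x, x⟫`. Along a trajectory `W` loses exactly twice the
dissipation `J = ∫ ⟪M x, x⟫` (`IsGradientFlow.energy_sub_eq`), so it suffices to bound `J` over a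
window of length `T` from below by a multiple of `W` at the end of that window.

Two facts give this bound. For a frozen vector `v` the window is excited: `∫ ⟪M v, v⟫ ≥ ι̲₂ ‖v‖²`
(`NetworkAssumption.iota2Lower_mul_le`). Here `v` splits orthogonally into the average over the
agents and a disagreement. The integrated Laplacian sees the disagreement, cooperative excitation
sees the average up to a cross term, and `ι̲₂` is the worst case over the split. Moreover the state
moves little when `J` is small: since `‖M v‖² ≤ r ⟪M v, v⟫`, the squared drift is at most a multiple
of `J`, so freezing the state at the end of the window costs a factor at most `(1 + √φ₁)²`
(`IsGradientFlow.integral_frozen_le`).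

Hence `J ≥ ι̲₂ / (1 + √φ₁)² ‖x‖²` at the end of the window, and `ι̲₃` is at most this constant
(`iota3Lower_mul_le`). Each window divides `W` by at least `1 + 2 ι̲₃ / λ_max(P)`. An elementary
inequality turns this geometric decay into the stated exponential (`pow_inv_le_exp`); `ῑ₃` enters
only through `ι̲₃ ≤ ῑ₃`. -/

namespace CIEstimator

open MeasureTheory Set Filter Topology Interval

/-! ### Gradient flows in an inner product space: drift, frozen states, energy. -/

section Flow

variable {E : Type*} [NormedAddCommGroup E] [InnerProductSpace ℝ E]

/-- For a positive operator, a bound of the quadratic form bounds the operator itself. -/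
lemma norm_sq_apply_le_of_inner_le {A : E →L[ℝ] E} (hA : A.IsPositive) {r : ℝ} (hr : 0 < r)
    (h : ∀ v, inner ℝ (A v) v ≤ r * ‖v‖ ^ 2) (v : E) :
    ‖A v‖ ^ 2 ≤ r * inner ℝ (A v) v := by
  -- Positivity at this vector reads `⟪A v, v⟫ - 2 r⁻¹ ‖A v‖² + r⁻² ⟪A (A v), A v⟫ ≥ 0`, and the
  -- last term is at most `r⁻¹ ‖A v‖²`. This avoids the square root of `A`.
  have h0 := hA.inner_nonneg_left (v - r⁻¹ • A v)
  have h1 := h (A v)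
  have hs : inner ℝ (A (A v)) v = ‖A v‖ ^ 2 := by
    rw [hA.inner_left_eq_inner_right, real_inner_self_eq_norm_sq]
  simp only [map_sub, map_smul, inner_sub_left, inner_sub_right, inner_smul_left,
    inner_smul_right, hs, real_inner_self_eq_norm_sq, RCLike.conj_to_real] at h0
  have h2 : r⁻¹ * (r⁻¹ * inner ℝ (A (A v)) (A v)) ≤ r⁻¹ * ‖A v‖ ^ 2 := by
    calc r⁻¹ * (r⁻¹ * inner ℝ (A (A v)) (A v)) ≤ r⁻¹ * (r⁻¹ * (r * ‖A v‖ ^ 2)) := by gcongr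
      _ = r⁻¹ * ‖A v‖ ^ 2 := by field_simp
  have h3 : r⁻¹ * ‖A v‖ ^ 2 ≤ inner ℝ (A v) v := by linarith
  calc ‖A v‖ ^ 2 = r * (r⁻¹ * ‖A v‖ ^ 2) := by field_simp
    _ ≤ r * inner ℝ (A v) v := by gcongr

lemma norm_apply_le_of_inner_le {A : E →L[ℝ] E} (hA : A.IsPositive) {r : ℝ} (hr : 0 < r)
    (h : ∀ v, inner ℝ (A v) v ≤ r * ‖v‖ ^ 2) (v : E) : ‖A v‖ ≤ r * ‖v‖ := by
  have h1 := norm_sq_apply_le_of_inner_le hA hr h v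
  have h2 : ‖A v‖ ^ 2 ≤ (r * ‖v‖) ^ 2 := by
    calc ‖A v‖ ^ 2 ≤ r * inner ℝ (A v) v := h1
      _ ≤ r * (r * ‖v‖ ^ 2) := by gcongr; exact h v
      _ = _ := by ring
  exact abs_le_of_sq_le_sq' h2 (by positivity) |>.2

/-- Young's inequality for the quadratic form of a positive operator. -/
lemma inner_apply_add_le {A : E →L[ℝ] E} (hA : A.IsPositive) {δ : ℝ} (hδ : 0 < δ) (v w : E) :
    inner ℝ (A (v - w)) (v - w) ≤
      (1 + δ) * inner ℝ (A v) v + (1 + δ⁻¹) * inner ℝ (A w) w := by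
  -- Divided by `δ`, positivity here bounds the cross term `-2 ⟪A v, w⟫` by `δ ⟪A v, v⟫ + δ⁻¹ ⟪A w,
  -- w⟫`.
  have h0 := hA.inner_nonneg_left (δ • v + w)
  have hs : inner ℝ (A w) v = inner ℝ (A v) w := by
    rw [hA.inner_left_eq_inner_right, real_inner_comm]
  simp only [map_add, map_sub, map_smul, inner_add_left, inner_add_right, inner_sub_left,
    inner_sub_right, inner_smul_left, inner_smul_right, hs, RCLike.conj_to_real] at h0 ⊢
  have h1 : 0 ≤ δ⁻¹ * (δ * (δ * inner ℝ (A v) v + inner ℝ (A v) w)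
      + (δ * inner ℝ (A v) w + inner ℝ (A w) w)) := mul_nonneg (by positivity) h0
  have h2 : δ⁻¹ * (δ * (δ * inner ℝ (A v) v + inner ℝ (A v) w)
      + (δ * inner ℝ (A v) w + inner ℝ (A w) w)) =
      δ * inner ℝ (A v) v + 2 * inner ℝ (A v) w + δ⁻¹ * inner ℝ (A w) w := by
    field_simp; ring
  linarith

/-- The Cauchy–Schwarz inequality against the constant function. -/
lemma sq_intervalIntegral_le {g : ℝ → ℝ} {a b : ℝ} (hab : a ≤ b)
    (hg : IntervalIntegrable g volume a b)
    (hg2 : IntervalIntegrable (fun s => g s ^ 2) volume a b) :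
    (∫ s in a..b, g s) ^ 2 ≤ (b - a) * ∫ s in a..b, g s ^ 2 := by
  rcases hab.eq_or_lt with rfl | hab
  · simp
  have hba : 0 < b - a := sub_pos.2 hab
  -- With `m` the mean of `g`, the inequality is the nonnegativity of the variance.
  set m := (∫ s in a..b, g s) / (b - a) with hm
  have h0 : 0 ≤ ∫ s in a..b, (g s - m) ^ 2 :=
    intervalIntegral.integral_nonneg hab.le fun s _ => sq_nonneg _
  have h1 : ∫ s in a..b, (g s - m) ^ 2 =
      (∫ s in a..b, g s ^ 2) - 2 * m * (∫ s in a..b, g s) + (b - a) * m ^ 2 := by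
    have : (fun s => (g s - m) ^ 2) = fun s => (g s ^ 2 - 2 * m * g s) + m ^ 2 := by
      funext s; ring
    rw [this, intervalIntegral.integral_add (hg2.sub (hg.const_mul _)) (by simp),
      intervalIntegral.integral_sub hg2 (hg.const_mul _), intervalIntegral.integral_const_mul]
    simp
  have h2 : ∫ s in a..b, g s = (b - a) * m := by rw [hm]; field_simp
  rw [h1, h2] at h0
  rw [h2]
  nlinarith

/-- A gradient flow `x' = -Γ A(t) x` on `[t₀, ∞)`, in integrated form, whose time-dependent positive
operator `A(t)` is measurable and bounded by `r` in the sense of quadratic forms. -/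
structure IsGradientFlow (A : ℝ → E →L[ℝ] E) (Γ : E →L[ℝ] E) (r t₀ : ℝ) (x : ℝ → E) : Prop where
  r_pos : 0 < r
  meas : AEStronglyMeasurable A (volume.restrict (Ici t₀))
  pos : ∀ s, t₀ ≤ s → (A s).IsPositive
  bound : ∀ s, t₀ ≤ s → ∀ v, inner ℝ (A s v) v ≤ r * ‖v‖ ^ 2
  cont : ContinuousOn x (Ici t₀)
  eq : ∀ t, t₀ ≤ t → x t = x t₀ + ∫ s in t₀..t, -(Γ (A s (x s)))

namespace IsGradientFlow

variable {A : ℝ → E →L[ℝ] E} {Γ : E →L[ℝ] E} {r t₀ : ℝ} {x : ℝ → E}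

lemma exists_bound (_h : IsGradientFlow A Γ r t₀ x) {y : ℝ → E} (hy : ContinuousOn y (Ici t₀))
    {a b : ℝ} (ha : t₀ ≤ a) (hb : t₀ ≤ b) : ∃ R, 0 ≤ R ∧ ∀ s ∈ uIcc a b, ‖y s‖ ≤ R := by
  have hsub : uIcc a b ⊆ Ici t₀ := fun s hs => (le_min ha hb).trans hs.1
  obtain ⟨R, hR⟩ := isCompact_uIcc.exists_bound_of_continuousOn (hy.mono hsub)
  exact ⟨R, (norm_nonneg _).trans (hR a left_mem_uIcc), hR⟩

/-- The curve `y` need not be the trajectory: frozen states are needed as well. -/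
lemma intervalIntegrable_apply (h : IsGradientFlow A Γ r t₀ x) {y : ℝ → E}
    (hy : ContinuousOn y (Ici t₀)) {a b : ℝ} (ha : t₀ ≤ a) (hb : t₀ ≤ b) :
    IntervalIntegrable (fun s => A s (y s)) volume a b := by
  obtain ⟨R, hR0, hR⟩ := h.exists_bound hy ha hb
  have hsub : Ι a b ⊆ Ici t₀ := fun s hs => (le_min ha hb).trans hs.1.le
  have hym := hy.aestronglyMeasurable (μ := volume) measurableSet_Ici
  rw [intervalIntegrable_iff]
  have : IsFiniteMeasure (volume.restrict (Ι a b)) := isFiniteMeasure_restrict.2 (by simp [uIoc])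
  refine Integrable.of_bound (C := r * R) ?_ ?_
  · exact (((ContinuousLinearMap.id ℝ (E →L[ℝ] E)).aestronglyMeasurable_comp₂
      h.meas hym).mono_measure (Measure.restrict_mono hsub le_rfl))
  · refine (ae_restrict_iff' measurableSet_uIoc).2 (.of_forall fun s hs => ?_)
    exact (norm_apply_le_of_inner_le (h.pos s (hsub hs)) h.r_pos (h.bound s (hsub hs)) _).trans
      (mul_le_mul_of_nonneg_left (hR s (uIoc_subset_uIcc hs)) h.r_pos.le)

lemma intervalIntegrable_inner (h : IsGradientFlow A Γ r t₀ x) {y z : ℝ → E}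
    (hy : ContinuousOn y (Ici t₀)) (hz : ContinuousOn z (Ici t₀)) {a b : ℝ}
    (ha : t₀ ≤ a) (hb : t₀ ≤ b) :
    IntervalIntegrable (fun s => inner ℝ (A s (y s)) (z s)) volume a b := by
  obtain ⟨R, hR0, hR⟩ := h.exists_bound hz ha hb
  have hsub : Ι a b ⊆ Ici t₀ := fun s hs => (le_min ha hb).trans hs.1.le
  have hzm := hz.aestronglyMeasurable (μ := volume) measurableSet_Ici
  have hA := h.intervalIntegrable_apply hy ha hb
  rw [intervalIntegrable_iff] at hA ⊢
  refine (hA.norm.mul_const R).mono'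
    (hA.aestronglyMeasurable.inner (hzm.mono_measure (Measure.restrict_mono hsub le_rfl))) ?_
  refine (ae_restrict_iff' measurableSet_uIoc).2 (.of_forall fun s hs => ?_)
  exact (norm_inner_le_norm _ _).trans
    (mul_le_mul_of_nonneg_left (hR s (uIoc_subset_uIcc hs)) (norm_nonneg _))

lemma intervalIntegrable_norm_sq (h : IsGradientFlow A Γ r t₀ x) {y : ℝ → E}
    (hy : ContinuousOn y (Ici t₀)) {a b : ℝ} (ha : t₀ ≤ a) (hb : t₀ ≤ b) :
    IntervalIntegrable (fun s => ‖A s (y s)‖ ^ 2) volume a b := by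
  have hsub : Ι a b ⊆ Ici t₀ := fun s hs => (le_min ha hb).trans hs.1.le
  have hA := h.intervalIntegrable_apply hy ha hb
  have hI := h.intervalIntegrable_inner hy hy ha hb
  rw [intervalIntegrable_iff] at hA hI ⊢
  refine (hI.const_mul r).mono' (hA.aestronglyMeasurable.norm.pow 2) ?_
  refine (ae_restrict_iff' measurableSet_uIoc).2 (.of_forall fun s hs => ?_)
  rw [Real.norm_of_nonneg (by positivity)]
  exact norm_sq_apply_le_of_inner_le (h.pos s (hsub hs)) h.r_pos (h.bound s (hsub hs)) _

lemma intervalIntegrable_rhs [CompleteSpace E] (h : IsGradientFlow A Γ r t₀ x) {a b : ℝ}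
    (ha : t₀ ≤ a) (hb : t₀ ≤ b) :
    IntervalIntegrable (fun s => -(Γ (A s (x s)))) volume a b := by
  have hA := h.intervalIntegrable_apply h.cont ha hb
  rw [intervalIntegrable_iff] at hA ⊢
  exact (Γ.integrable_comp hA).neg

lemma sub_eq [CompleteSpace E] (h : IsGradientFlow A Γ r t₀ x) {a b : ℝ}
    (ha : t₀ ≤ a) (hb : t₀ ≤ b) : x b = x a + ∫ s in a..b, -(Γ (A s (x s))) := by
  rw [h.eq b hb, h.eq a ha, add_assoc, intervalIntegral.integral_add_adjacent_intervals
    (h.intervalIntegrable_rhs le_rfl ha) (h.intervalIntegrable_rhs ha hb)]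

/-- The dissipation `∫ ⟪A x, x⟫` over a window controls the drift of the trajectory. -/
lemma norm_sub_sq_le [CompleteSpace E] (h : IsGradientFlow A Γ r t₀ x) {a s b : ℝ}
    (ha : t₀ ≤ a) (has : a ≤ s) (hsb : s ≤ b) :
    ‖x b - x s‖ ^ 2 ≤ ‖Γ‖ ^ 2 * ((b - s) * (r * ∫ u in a..b, inner ℝ (A u (x u)) (x u))) := by
  have hs : t₀ ≤ s := ha.trans has
  have hb : t₀ ≤ b := hs.trans hsb
  have hA := h.intervalIntegrable_apply h.cont hs hb
  have h1 : ‖x b - x s‖ ≤ ‖Γ‖ * ∫ u in s..b, ‖A u (x u)‖ := by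
    rw [h.sub_eq hs hb, add_sub_cancel_left, intervalIntegral.integral_neg, norm_neg,
      Γ.intervalIntegral_comp_comm hA]
    exact (Γ.le_opNorm _).trans (mul_le_mul_of_nonneg_left
      (intervalIntegral.norm_integral_le_integral_norm hsb) (norm_nonneg _))
  have h2 := sq_intervalIntegral_le hsb hA.norm (h.intervalIntegrable_norm_sq h.cont hs hb)
  have h3 : ∫ u in s..b, ‖A u (x u)‖ ^ 2 ≤ r * ∫ u in s..b, inner ℝ (A u (x u)) (x u) := by
    rw [← intervalIntegral.integral_const_mul]
    refine intervalIntegral.integral_mono_on hsb (h.intervalIntegrable_norm_sq h.cont hs hb)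
      ((h.intervalIntegrable_inner h.cont h.cont hs hb).const_mul r) fun u hu => ?_
    exact norm_sq_apply_le_of_inner_le (h.pos u (hs.trans hu.1)) h.r_pos
      (h.bound u (hs.trans hu.1)) _
  have h4 : ∫ u in s..b, inner ℝ (A u (x u)) (x u) ≤ ∫ u in a..b, inner ℝ (A u (x u)) (x u) := by
    rw [← intervalIntegral.integral_add_adjacent_intervals
      (h.intervalIntegrable_inner h.cont h.cont ha hs)
      (h.intervalIntegrable_inner h.cont h.cont hs hb)]
    have : 0 ≤ ∫ u in a..s, inner ℝ (A u (x u)) (x u) :=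
      intervalIntegral.integral_nonneg has fun u hu =>
        (h.pos u (ha.trans hu.1)).inner_nonneg_left _
    linarith
  have hr := h.r_pos
  have hbs : 0 ≤ b - s := sub_nonneg.2 hsb
  calc ‖x b - x s‖ ^ 2 ≤ (‖Γ‖ * ∫ u in s..b, ‖A u (x u)‖) ^ 2 := by gcongr
    _ = ‖Γ‖ ^ 2 * (∫ u in s..b, ‖A u (x u)‖) ^ 2 := by ring
    _ ≤ ‖Γ‖ ^ 2 * ((b - s) * ∫ u in s..b, ‖A u (x u)‖ ^ 2) := by gcongr
    _ ≤ ‖Γ‖ ^ 2 * ((b - s) * (r * ∫ u in s..b, inner ℝ (A u (x u)) (x u))) := by gcongr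
    _ ≤ _ := by gcongr

/-- Observability of the flow from that of the frozen state. -/
lemma integral_frozen_le [CompleteSpace E] (h : IsGradientFlow A Γ r t₀ x) {a b f : ℝ}
    (ha : t₀ ≤ a) (hab : a ≤ b) (hf : 0 < f)
    (hf2 : 1 / 2 * ‖Γ‖ ^ 2 * ((b - a) * r) ^ 2 ≤ f ^ 2) :
    ∫ s in a..b, inner ℝ (A s (x b)) (x b) ≤
      (1 + f) ^ 2 * ∫ s in a..b, inner ℝ (A s (x s)) (x s) := by
  have hb : t₀ ≤ b := ha.trans hab
  have hr := h.r_pos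
  have hc : ContinuousOn (fun _ : ℝ => x b) (Ici t₀) := continuousOn_const
  set J := ∫ s in a..b, inner ℝ (A s (x s)) (x s) with hJ
  have hJ0 : 0 ≤ J := intervalIntegral.integral_nonneg hab fun u hu =>
        (h.pos u (ha.trans hu.1)).inner_nonneg_left _
  have hI := h.intervalIntegrable_inner h.cont h.cont ha hb
  have hlin : IntervalIntegrable (fun s => (b - s) * (r ^ 2 * ‖Γ‖ ^ 2 * J)) volume a b :=
    Continuous.intervalIntegrable (by fun_prop) _ _
  have key : ∫ s in a..b, inner ℝ (A s (x b)) (x b) ≤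
      ∫ s in a..b, ((1 + f) * inner ℝ (A s (x s)) (x s)
        + (1 + f⁻¹) * ((b - s) * (r ^ 2 * ‖Γ‖ ^ 2 * J))) := by
    refine intervalIntegral.integral_mono_on hab (h.intervalIntegrable_inner hc hc ha hb)
      ((hI.const_mul _).add (hlin.const_mul _)) fun s hs => ?_
    have hs0 : t₀ ≤ s := ha.trans hs.1
    -- The frozen state is `x b = x s - (x s - x b)`: the true state minus its drift.
    have h1 := inner_apply_add_le (h.pos s hs0) hf (x s) (x s - x b)
    rw [sub_sub_cancel] at h1
    have h2 : inner ℝ (A s (x s - x b)) (x s - x b) ≤ (b - s) * (r ^ 2 * ‖Γ‖ ^ 2 * J) := by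
      calc inner ℝ (A s (x s - x b)) (x s - x b) ≤ r * ‖x b - x s‖ ^ 2 := by
            rw [norm_sub_rev]; exact h.bound s hs0 _
        _ ≤ r * (‖Γ‖ ^ 2 * ((b - s) * (r * J))) := by
            gcongr; exact h.norm_sub_sq_le ha hs.1 hs.2
        _ = _ := by ring
    refine h1.trans ?_
    gcongr
  -- The drift bound grows linearly with the time to the end of the window; this integral is the
  -- origin of the factor `1 / 2` in `φ₁`.
  have hint : ∫ s in a..b, (b - s) = (b - a) ^ 2 / 2 := by
    rw [intervalIntegral.integral_comp_sub_left (fun u => u)]; simp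
  rw [intervalIntegral.integral_add (hI.const_mul _) (hlin.const_mul _),
    intervalIntegral.integral_const_mul, intervalIntegral.integral_const_mul,
    intervalIntegral.integral_mul_const, hint] at key
  refine key.trans ?_
  have h3 : (b - a) ^ 2 / 2 * (r ^ 2 * ‖Γ‖ ^ 2 * J) ≤ f ^ 2 * J := by
    calc (b - a) ^ 2 / 2 * (r ^ 2 * ‖Γ‖ ^ 2 * J)
        = 1 / 2 * ‖Γ‖ ^ 2 * ((b - a) * r) ^ 2 * J := by ring
      _ ≤ f ^ 2 * J := by gcongr
  -- The Young weight `f` minimises `(1 + δ) + (1 + δ⁻¹) f²` over `δ > 0`, with minimum `(1 + f)²`.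
  calc (1 + f) * J + (1 + f⁻¹) * ((b - a) ^ 2 / 2 * (r ^ 2 * ‖Γ‖ ^ 2 * J))
      ≤ (1 + f) * J + (1 + f⁻¹) * (f ^ 2 * J) := by gcongr
    _ = (1 + f) ^ 2 * J := by field_simp; ring

end IsGradientFlow

/-- The derivative of a quadratic form along an absolutely continuous curve, integrated. -/
lemma quadratic_sub_eq_integral [CompleteSpace E] {P : E →L[ℝ] E}
    (hP : ∀ v w, inner ℝ (P v) w = inner ℝ v (P w)) {x f : ℝ → E} {a b K : ℝ} (hab : a ≤ b)
    (hf : IntervalIntegrable f volume a b) (hK : ∀ s ∈ Icc a b, ‖f s‖ ≤ K)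
    (hx : ∀ t ∈ Icc a b, x t = x a + ∫ s in a..t, f s) :
    inner ℝ (P (x b)) (x b) - inner ℝ (P (x a)) (x a) =
      ∫ s in a..b, 2 * inner ℝ (P (x s)) (f s) := by
  have hK0 : 0 ≤ K := (norm_nonneg _).trans (hK a (left_mem_Icc.2 hab))
  have hsubI : ∀ {s t}, s ∈ Icc a b → t ∈ Icc a b → IntervalIntegrable f volume s t :=
    fun hs ht => hf.mono_set (by rw [uIcc_of_le hab]; exact ordConnected_Icc.uIcc_subset hs ht)
  have haI : a ∈ Icc a b := left_mem_Icc.2 hab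
  have hlip : ∀ s ∈ Icc a b, ∀ t ∈ Icc a b, ‖x s - x t‖ ≤ K * |s - t| := by
    intro s hs t ht
    rw [hx s hs, hx t ht, add_sub_add_left_eq_sub,
      intervalIntegral.integral_interval_sub_left (hsubI haI hs) (hsubI haI ht)]
    refine intervalIntegral.norm_integral_le_of_norm_le_const fun u hu => hK u ?_
    exact ordConnected_Icc.uIcc_subset ht hs (uIoc_subset_uIcc hu)
  obtain ⟨R, hR0, hR⟩ : ∃ R, 0 ≤ R ∧ ∀ s ∈ Icc a b, ‖x s‖ ≤ R := by
    refine ⟨‖x a‖ + K * (b - a), by have := sub_nonneg.2 hab; positivity, fun s hs => ?_⟩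
    have h1 := hlip s hs a haI
    rw [abs_of_nonneg (sub_nonneg.2 hs.1)] at h1
    have h2 : K * (s - a) ≤ K * (b - a) := by gcongr; exact hs.2
    linarith [norm_le_norm_add_norm_sub (x a) (x s), norm_sub_rev (x a) (x s)]
  -- The integrand `f` is bounded, so `x` and its quadratic form are Lipschitz. The fundamental
  -- theorem for absolutely continuous functions then needs the derivative only almost everywhere.
  have hW : AbsolutelyContinuousOnInterval (fun t => inner ℝ (P (x t)) (x t)) a b := by
    refine LipschitzOnWith.absolutelyContinuousOnInterval 
      (K := (2 * ‖P‖ * R * K).toNNReal) ?_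
    rw [uIcc_of_le hab]
    refine LipschitzOnWith.of_dist_le_mul fun s hs t ht => ?_
    have h1 : inner ℝ (P (x s)) (x s) - inner ℝ (P (x t)) (x t) =
        inner ℝ (P (x s - x t)) (x s) + inner ℝ (P (x t)) (x s - x t) := by
      simp only [map_sub, inner_sub_left, inner_sub_right]; ring
    rw [Real.dist_eq, h1, Real.coe_toNNReal _ (by positivity), Real.dist_eq]
    have h2 : |inner ℝ (P (x s - x t)) (x s)| ≤ ‖P‖ * (K * |s - t|) * R := by
      refine (abs_real_inner_le_norm _ _).trans ?_
      gcongr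
      · exact P.le_opNorm_of_le (hlip s hs t ht)
      · exact hR s hs
    have h3 : |inner ℝ (P (x t)) (x s - x t)| ≤ ‖P‖ * R * (K * |s - t|) := by
      refine (abs_real_inner_le_norm _ _).trans ?_
      gcongr
      · exact P.le_opNorm_of_le (hR t ht)
      · exact hlip s hs t ht
    calc _ ≤ _ := abs_add_le _ _
      _ ≤ _ := add_le_add h2 h3
      _ = _ := by ring
  rw [← hW.integral_deriv_eq_sub]
  refine intervalIntegral.integral_congr_ae ?_
  -- The end point `b` is discarded because the integral formula for `x` is known only on `[a, b]`,
  -- while a derivative needs a neighbourhood.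
  filter_upwards [hf.ae_hasDerivAt_integral, Measure.ae_ne volume b] with t ht htb htI
  rw [uIoc_of_le hab] at htI
  have hd := ht (by rw [uIcc_of_le hab]; exact ⟨htI.1.le, htI.2⟩) a left_mem_uIcc
  have hnhds : Ioo a b ∈ 𝓝 t := Ioo_mem_nhds htI.1 (lt_of_le_of_ne htI.2 htb)
  have hdx : HasDerivAt x (f t) t :=
    (hd.const_add (x a)).congr_of_eventuallyEq
      (by filter_upwards [hnhds] with u hu using hx u ⟨hu.1.le, hu.2.le⟩)
  have hdW := ((P.hasFDerivAt (x := x t)).comp_hasDerivAt t hdx).inner ℝ hdx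
  refine hdW.deriv.trans ?_
  rw [Function.comp_apply, hP (f t) (x t), real_inner_comm (P (x t)) (f t)]
  ring

/-- The energy identity of a gradient flow. -/
lemma IsGradientFlow.energy_sub_eq [CompleteSpace E] {A : ℝ → E →L[ℝ] E} {Γ P : E →L[ℝ] E}
    {r t₀ : ℝ} {x : ℝ → E} (h : IsGradientFlow A Γ r t₀ x)
    (hP : ∀ v w, inner ℝ (P v) w = inner ℝ v (P w)) (hPΓ : ∀ v, P (Γ v) = v)
    {a b : ℝ} (ha : t₀ ≤ a) (hab : a ≤ b) :
    inner ℝ (P (x a)) (x a) - inner ℝ (P (x b)) (x b) =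
      2 * ∫ s in a..b, inner ℝ (A s (x s)) (x s) := by
  have hb := ha.trans hab
  obtain ⟨R, hR0, hR⟩ := h.exists_bound h.cont ha hb
  rw [uIcc_of_le hab] at hR
  have := quadratic_sub_eq_integral hP hab (h.intervalIntegrable_rhs ha hb)
    (K := ‖Γ‖ * (r * R)) (x := x) (fun s hs => ?_) (fun t ht => h.sub_eq ha (ha.trans ht.1))
  · rw [← neg_sub, this, ← intervalIntegral.integral_neg, ← intervalIntegral.integral_const_mul]
    refine intervalIntegral.integral_congr fun s _ => ?_
    rw [hP, map_neg, hPΓ, inner_neg_right, real_inner_comm]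
    ring
  · rw [norm_neg]
    exact Γ.le_opNorm_of_le ((norm_apply_le_of_inner_le (h.pos s (ha.trans hs.1)) h.r_pos
      (h.bound s (ha.trans hs.1)) _).trans (mul_le_mul_of_nonneg_left (hR s hs) h.r_pos.le))

end Flow

end CIEstimator

/-! ### Scalar inequalities for the constants. -/

namespace CIEstimator

lemma phi1_nonneg (r b : ℝ) : 0 ≤ phi1 r b := by unfold phi1; positivity

/-- A formula for `ι̲₃` that needs no case distinction. -/
lemma iota3Lower_eq {r a b : ℝ} (hb : 0 < b) (hab : a ≤ b) (ha : 0 ≤ a) :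
    iota3Lower r a b =
      (a / (Real.sqrt (b - a + phi1 r b * a) + Real.sqrt b)) ^ 2 := by
  have hφ := phi1_nonneg r b
  have hsb := Real.sqrt_pos.2 hb
  unfold iota3Lower
  split_ifs with h
  · have hb2 := Real.sq_sqrt hb.le
    rw [h, one_mul, sub_add_cancel, div_pow, ← two_mul, mul_pow, hb2]
    norm_num
  · congr 1
    have hX : 0 ≤ b - a + phi1 r b * a := by have := mul_nonneg hφ ha; linarith
    have h1 := Real.mul_self_sqrt hX
    have h2 := Real.mul_self_sqrt hb.le
    have h3 := Real.sqrt_nonneg (b - a + phi1 r b * a)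
    have h4 : phi1 r b - 1 ≠ 0 := sub_ne_zero.2 h
    rw [div_eq_div_iff h4 (by positivity)]
    -- The radicand minus `b` is `a (φ₁ - 1)`, so the identity is the rationalisation of a
    -- difference of square roots.
    linear_combination h1 - h2

lemma iota3Lower_nonneg {r a b : ℝ} (hb : 0 < b) (hab : a ≤ b) (ha : 0 ≤ a) :
    0 ≤ iota3Lower r a b := by
  rw [iota3Lower_eq hb hab ha]; positivity

/-- Since `a ≤ b`, the denominator in `iota3Lower_eq` is at least `√a (1 + √φ₁)`. The factor `(1 +
√φ₁)²` is the price of freezing the state in `IsGradientFlow.integral_frozen_le`. -/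
lemma iota3Lower_mul_le {r a b : ℝ} (hb : 0 < b) (hab : a ≤ b) (ha : 0 ≤ a) :
    iota3Lower r a b * (1 + Real.sqrt (phi1 r b)) ^ 2 ≤ a := by
  have hφ := phi1_nonneg r b
  have hsb := Real.sqrt_pos.2 hb
  rw [iota3Lower_eq hb hab ha]
  have h1 : Real.sqrt a ≤ Real.sqrt b := Real.sqrt_le_sqrt hab
  have h2 : Real.sqrt (phi1 r b) * Real.sqrt a ≤ Real.sqrt (b - a + phi1 r b * a) := by
    rw [← Real.sqrt_mul hφ]; exact Real.sqrt_le_sqrt (by linarith)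
  set D := Real.sqrt (b - a + phi1 r b * a) + Real.sqrt b with hD
  have hD0 : 0 < D := by positivity
  have h3 : (Real.sqrt a * (1 + Real.sqrt (phi1 r b))) ^ 2 ≤ D ^ 2 := by
    gcongr; rw [hD]; linarith
  rw [mul_pow, Real.sq_sqrt ha] at h3
  calc (a / D) ^ 2 * (1 + Real.sqrt (phi1 r b)) ^ 2
      = a * (a * (1 + Real.sqrt (phi1 r b)) ^ 2) / D ^ 2 := by rw [div_pow]; ring
    _ ≤ a * D ^ 2 / D ^ 2 := by gcongr
    _ = a := by field_simp

lemma iota3Lower_le_iota3Upper {r a b : ℝ} (hb : 0 < b) (hab : a ≤ b) (ha : 0 ≤ a) :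
    iota3Lower r a b ≤ iota3Upper r a b := by
  have h1 : iota3Lower r a b ≤ a := by
    refine le_trans ?_ (iota3Lower_mul_le (r := r) hb hab ha)
    refine le_mul_of_one_le_right ?_ (one_le_pow₀ (by linarith [Real.sqrt_nonneg (phi1 r b)]))
    rw [iota3Lower_eq hb hab ha]; positivity
  have h2 : b ≤ iota3Upper r a b := by
    unfold iota3Upper
    calc b = Real.sqrt b ^ 2 := (Real.sq_sqrt hb.le).symm
      _ ≤ _ := by
        gcongr
        exact le_add_of_nonneg_left (Real.sqrt_nonneg _)
  exact h1.trans (hab.trans h2)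

/-- Geometric decay over whole windows is at least as fast as the exponential bound. -/
lemma pow_inv_le_exp {p P θ : ℝ} (hp : 0 ≤ p) (hpP : p ≤ P) (k : ℕ) (hθ : θ ≤ k + 1) :
    ((1 + p) ^ k)⁻¹ ≤ (1 + P) * Real.exp (-(p / (1 + P)) * θ) := by
  have hP : 0 ≤ P := hp.trans hpP
  have hc : 0 ≤ p / (1 + P) := by positivity
  -- This follows from `log (1 + q) ≥ q / (1 + q) ≥ p / (1 + P)`. The choice `q = p` serves the `k`
  -- full windows; `q = P` pays for the incomplete last one.
  have step : ∀ q, 0 ≤ q → p ≤ q → q ≤ P → Real.exp (p / (1 + P)) ≤ 1 + q := by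
    intro q hq hpq hqP
    rw [← Real.le_log_iff_exp_le (by linarith)]
    have h1 := Real.one_sub_inv_le_log_of_pos (show 0 < 1 + q by linarith)
    refine le_trans ?_ h1
    have : 1 - (1 + q)⁻¹ = q / (1 + q) := by field_simp; ring
    rw [this]
    gcongr
  have h1 : Real.exp (p / (1 + P) * θ) ≤ (1 + P) * (1 + p) ^ k := by
    calc Real.exp (p / (1 + P) * θ) ≤ Real.exp (p / (1 + P) * ((k + 1 : ℕ) : ℝ)) := by
          push_cast; gcongr
      _ = Real.exp (p / (1 + P)) * Real.exp (p / (1 + P)) ^ k := by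
          rw [mul_comm, Real.exp_nat_mul, pow_succ']
      _ ≤ (1 + P) * (1 + p) ^ k := by
          gcongr
          · exact step P hP hpP le_rfl
          · exact step p hp le_rfl hpP
  rw [neg_mul, Real.exp_neg, inv_le_iff_one_le_mul₀ (by positivity)]
  have he := Real.exp_pos (p / (1 + P) * θ)
  calc (1 : ℝ) = Real.exp (p / (1 + P) * θ) * (Real.exp (p / (1 + P) * θ))⁻¹ := by field_simp
    _ ≤ (1 + P) * (1 + p) ^ k * (Real.exp (p / (1 + P) * θ))⁻¹ := by gcongr
    _ = _ := by ring

end CIEstimator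

/-! ### Contraction over a window and exponential decay. -/

namespace CIEstimator

open MeasureTheory Set

section Decay

variable {E : Type*} [NormedAddCommGroup E] [InnerProductSpace ℝ E] [CompleteSpace E]
  {A : ℝ → E →L[ℝ] E} {Γ P : E →L[ℝ] E} {r t₀ T a g l : ℝ} {x : ℝ → E}

/-- The quadratic form `⟪P x, x⟫`, with `P` the inverse of the gain, is contracted over every window
on which the frozen flow is excited. -/
lemma IsGradientFlow.energy_window_le (h : IsGradientFlow A Γ r t₀ x)
    (hP : ∀ v w, inner ℝ (P v) w = inner ℝ v (P w)) (hPΓ : ∀ v, P (Γ v) = v) (hΓ : 0 < ‖Γ‖)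
    (hT : 0 < T) (hg : 0 < g) (hPg : ∀ v, inner ℝ (P v) v ≤ g * ‖v‖ ^ 2) (ha : 0 ≤ a)
    (hab : a ≤ T * r)
    (hobs : ∀ s, t₀ ≤ s → ∀ v, a * ‖v‖ ^ 2 ≤ ∫ u in s..s + T, inner ℝ (A u v) v)
    {s : ℝ} (hs : t₀ ≤ s) :
    (1 + 2 * iota3Lower ‖Γ‖ a (T * r) / g) * inner ℝ (P (x (s + T))) (x (s + T)) ≤
      inner ℝ (P (x s)) (x s) := by
  have hr := h.r_pos
  have hTr : 0 < T * r := by positivity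
  set q := iota3Lower ‖Γ‖ a (T * r) with hq
  have hq0 : 0 ≤ q := iota3Lower_nonneg hTr hab ha
  have hφ : 0 < phi1 ‖Γ‖ (T * r) := by unfold phi1; positivity
  set f := Real.sqrt (phi1 ‖Γ‖ (T * r)) with hf
  have hf0 : 0 < f := Real.sqrt_pos.2 hφ
  -- Freezing at the end of the window bounds the loss of energy by the energy that remains, hence
  -- the form `(1 + p) W(s + T) ≤ W(s)`.
  have h1 := h.integral_frozen_le hs (show s ≤ s + T by linarith) hf0
    (by rw [hf, Real.sq_sqrt hφ.le, add_sub_cancel_left]; rfl)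
  have h2 := h.energy_sub_eq hP hPΓ hs (show s ≤ s + T by linarith)
  have h3 := hobs s hs (x (s + T))
  set J := ∫ u in s..s + T, inner ℝ (A u (x u)) (x u)
  have h4 : q * ‖x (s + T)‖ ^ 2 ≤ J := by
    have h5 : (1 + f) ^ 2 * (q * ‖x (s + T)‖ ^ 2) ≤ (1 + f) ^ 2 * J := by
      calc (1 + f) ^ 2 * (q * ‖x (s + T)‖ ^ 2) = (q * (1 + f) ^ 2) * ‖x (s + T)‖ ^ 2 := by ring
        _ ≤ a * ‖x (s + T)‖ ^ 2 := by gcongr; exact iota3Lower_mul_le hTr hab ha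
        _ ≤ _ := h3.trans h1
    exact le_of_mul_le_mul_left h5 (by positivity)
  have h6 : q / g * inner ℝ (P (x (s + T))) (x (s + T)) ≤ J := by
    calc q / g * inner ℝ (P (x (s + T))) (x (s + T)) ≤ q / g * (g * ‖x (s + T)‖ ^ 2) := by
          gcongr; exact hPg _
      _ = q * ‖x (s + T)‖ ^ 2 := by field_simp
      _ ≤ J := h4
  calc _ = inner ℝ (P (x (s + T))) (x (s + T))
        + 2 * (q / g * inner ℝ (P (x (s + T))) (x (s + T))) := by ring
    _ ≤ _ := by linarith

/-- Exponential decay of a gradient flow under persistent excitation. -/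
theorem IsGradientFlow.norm_le (h : IsGradientFlow A Γ r t₀ x)
    (hP : ∀ v w, inner ℝ (P v) w = inner ℝ v (P w)) (hPΓ : ∀ v, P (Γ v) = v) (hΓ : 0 < ‖Γ‖)
    (hT : 0 < T) (hl : 0 < l) (hg : 0 < g) (hPl : ∀ v, l * ‖v‖ ^ 2 ≤ inner ℝ (P v) v)
    (hPg : ∀ v, inner ℝ (P v) v ≤ g * ‖v‖ ^ 2) (ha : 0 ≤ a) (hab : a ≤ T * r)
    (hobs : ∀ s, t₀ ≤ s → ∀ v, a * ‖v‖ ^ 2 ≤ ∫ u in s..s + T, inner ℝ (A u v) v)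
    {κ₁ κ₂ : ℝ} (hκ₁ : κ₁ = T / 2 * g + T * iota3Upper ‖Γ‖ a (T * r)) (hκ₂ : κ₂ = T / 2 * l)
    {t : ℝ} (ht : t₀ ≤ t) :
    ‖x t‖ ≤ Real.sqrt (κ₁ / κ₂) * ‖x t₀‖ *
      Real.exp (-(iota3Lower ‖Γ‖ a (T * r) / (2 * κ₁)) * (t - t₀)) := by
  have hr := h.r_pos
  have hTr : 0 < T * r := by positivity
  have hq0 := iota3Lower_nonneg (r := ‖Γ‖) hTr hab ha
  have hqQ := iota3Lower_le_iota3Upper (r := ‖Γ‖) hTr hab ha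
  have hwin := fun {s} => h.energy_window_le hP hPΓ hΓ hT hg hPg ha hab hobs (s := s)
  set q := iota3Lower ‖Γ‖ a (T * r) with hq
  set Q := iota3Upper ‖Γ‖ a (T * r) with hQ
  have hQ0 : 0 ≤ Q := hq0.trans hqQ
  have hp0 : 0 ≤ 2 * q / g := by positivity
  have hiter : ∀ k : ℕ, (1 + 2 * q / g) ^ k * inner ℝ (P (x (t₀ + k * T))) (x (t₀ + k * T)) ≤
      inner ℝ (P (x t₀)) (x t₀) := by
    intro k
    induction k with
    | zero => simp
    | succ k ih =>
      have h1 := hwin (s := t₀ + k * T) (le_add_of_nonneg_right (by positivity))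
      rw [show t₀ + k * T + T = t₀ + ((k + 1 : ℕ) : ℝ) * T by push_cast; ring] at h1
      refine le_trans ?_ ih
      rw [pow_succ, mul_assoc]
      gcongr
  set k := ⌊(t - t₀) / T⌋₊ with hk
  have hθ0 : 0 ≤ (t - t₀) / T := div_nonneg (sub_nonneg.2 ht) hT.le
  have hkt : t₀ + k * T ≤ t := by
    have := Nat.floor_le hθ0
    rw [← hk, le_div_iff₀ hT] at this
    linarith
  have hθ : (t - t₀) / T ≤ k + 1 := (Nat.lt_floor_add_one _).le
  -- On the incomplete last window only monotonicity of the energy is available.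
  have hmono : inner ℝ (P (x t)) (x t) ≤ inner ℝ (P (x (t₀ + k * T))) (x (t₀ + k * T)) := by
    have hs : t₀ ≤ t₀ + k * T := le_add_of_nonneg_right (by positivity)
    have h1 := h.energy_sub_eq hP hPΓ hs hkt
    have h2 : 0 ≤ ∫ u in (t₀ + k * T)..t, inner ℝ (A u (x u)) (x u) :=
      intervalIntegral.integral_nonneg hkt fun u hu =>
        (h.pos u (hs.trans hu.1)).inner_nonneg_left _
    linarith
  have hexp := pow_inv_le_exp hp0 (show 2 * q / g ≤ 2 * Q / g by gcongr) k hθ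
  have hpk : 0 < (1 + 2 * q / g) ^ k := by positivity
  have hk1 : 0 < κ₁ := by rw [hκ₁]; positivity
  have hk2 : 0 < κ₂ := by rw [hκ₂]; positivity
  set e := Real.exp (-(q / (2 * κ₁)) * (t - t₀)) with he
  -- Since `κ₁ = (T g / 2) (1 + 2 Q / g)`, the rate `p / (1 + P)` per window is `q / κ₁` per unit of
  -- time. The norm gets half of it.
  have he2 : Real.exp (-(2 * q / g / (1 + 2 * Q / g)) * ((t - t₀) / T)) = e ^ 2 := by
    rw [he, ← Real.exp_nat_mul]
    congr 1
    rw [hκ₁]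
    push_cast
    field_simp
  rw [he2] at hexp
  have hW : inner ℝ (P (x t)) (x t) ≤ (1 + 2 * Q / g) * e ^ 2 * (g * ‖x t₀‖ ^ 2) := by
    calc inner ℝ (P (x t)) (x t) ≤ inner ℝ (P (x (t₀ + k * T))) (x (t₀ + k * T)) := hmono
      _ = ((1 + 2 * q / g) ^ k)⁻¹ * ((1 + 2 * q / g) ^ k *
          inner ℝ (P (x (t₀ + k * T))) (x (t₀ + k * T))) := by field_simp
      _ ≤ ((1 + 2 * q / g) ^ k)⁻¹ * (g * ‖x t₀‖ ^ 2) := by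
          exact mul_le_mul_of_nonneg_left ((hiter k).trans (hPg _)) (by positivity)
      _ ≤ _ := by gcongr
  refine le_of_sq_le_sq ?_ (by positivity)
  rw [mul_pow, mul_pow, Real.sq_sqrt (by positivity)]
  have h1 := (hPl (x t)).trans hW
  calc ‖x t‖ ^ 2 = l⁻¹ * (l * ‖x t‖ ^ 2) := by field_simp
    _ ≤ l⁻¹ * ((1 + 2 * Q / g) * e ^ 2 * (g * ‖x t₀‖ ^ 2)) := by gcongr
    _ = κ₁ / κ₂ * ‖x t₀‖ ^ 2 * e ^ 2 := by rw [hκ₁, hκ₂]; field_simp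

end Decay

end CIEstimator

/-! ### Quadratic forms of symmetric matrices. -/

namespace CIEstimator

open MeasureTheory Set
open scoped Matrix

lemma norm_toLp_sq {m : Type*} [Fintype m] (v : m → ℝ) :
    ‖WithLp.toLp 2 v‖ ^ 2 = ∑ i, v i ^ 2 :=
  EuclideanSpace.real_norm_sq_eq _

section QuadraticForms

variable {m : Type*} [Fintype m] [DecidableEq m]

lemma abs_dotProduct_mulVec_le (A : Matrix m m ℝ) (v w : m → ℝ) :
    |v ⬝ᵥ A *ᵥ w| ≤ inducedNorm A * (‖WithLp.toLp 2 v‖ * ‖WithLp.toLp 2 w‖) := by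
  have h1 := Matrix.inner_toEuclideanCLM A (WithLp.toLp 2 v) (WithLp.toLp 2 w)
  rw [← h1]
  refine (abs_real_inner_le_norm _ _).trans ?_
  have h2 := (Matrix.toEuclideanCLM (n := m) (𝕜 := ℝ) A).le_opNorm (WithLp.toLp 2 w)
  calc _ ≤ ‖WithLp.toLp 2 v‖ * (inducedNorm A * ‖WithLp.toLp 2 w‖) := by
        gcongr; exact h2
    _ = _ := by ring

lemma dotProduct_mulVec_le {A : Matrix m m ℝ} {r : ℝ} (hA : inducedNorm A ≤ r) (v : m → ℝ) :
    v ⬝ᵥ A *ᵥ v ≤ r * ‖WithLp.toLp 2 v‖ ^ 2 := by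
  refine (le_abs_self _).trans ((abs_dotProduct_mulVec_le A v v).trans ?_)
  rw [← sq]
  gcongr

lemma abs_apply_le_inducedNorm (A : Matrix m m ℝ) (i j : m) : |A i j| ≤ inducedNorm A := by
  have h := abs_dotProduct_mulVec_le A (Pi.single i 1) (Pi.single j 1)
  simpa using h

/-- The quadratic form of a symmetric matrix in a basis of eigenvectors. -/
lemma dotProduct_mulVec_eq_sum_eigenvalues {A : Matrix m m ℝ} (hA : A.IsHermitian) (v : m → ℝ) :
    v ⬝ᵥ A *ᵥ v =
      ∑ i, hA.eigenvalues i * inner ℝ (hA.eigenvectorBasis i) (WithLp.toLp 2 v) ^ 2 := by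
  set x : EuclideanSpace ℝ m := WithLp.toLp 2 v
  have h1 := Matrix.inner_toEuclideanCLM A x x
  have hb : ∀ i, Matrix.toEuclideanCLM (n := m) (𝕜 := ℝ) A (hA.eigenvectorBasis i) =
      hA.eigenvalues i • hA.eigenvectorBasis i := fun i => by
    apply WithLp.ofLp_injective 2
    rw [Matrix.ofLp_toEuclideanCLM]
    exact hA.mulVec_eigenvectorBasis i
  have hsymm : ∀ y z, inner ℝ y (Matrix.toEuclideanCLM (n := m) (𝕜 := ℝ) A z) =
      inner ℝ (Matrix.toEuclideanCLM (n := m) (𝕜 := ℝ) A y) z := fun y z => by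
    have hAT : Aᵀ = A := hA
    rw [real_inner_comm z, Matrix.inner_toEuclideanCLM, Matrix.inner_toEuclideanCLM,
      Matrix.dotProduct_mulVec, ← Matrix.mulVec_transpose, hAT, dotProduct_comm]
  rw [← h1, ← hA.eigenvectorBasis.sum_inner_mul_inner]
  refine Finset.sum_congr rfl fun i _ => ?_
  rw [hsymm, hb, inner_smul_left, real_inner_comm x]
  simp only [RCLike.conj_to_real]
  ring

lemma sum_inner_eigenvectorBasis_sq {A : Matrix m m ℝ} (hA : A.IsHermitian) (v : m → ℝ) :
    ∑ i, inner ℝ (hA.eigenvectorBasis i) (WithLp.toLp 2 v) ^ 2 = ‖WithLp.toLp 2 v‖ ^ 2 := by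
  rw [← real_inner_self_eq_norm_sq, ← hA.eigenvectorBasis.sum_inner_mul_inner]
  refine Finset.sum_congr rfl fun i _ => ?_
  rw [real_inner_comm, sq]

lemma lambdaMin_mul_le {A : Matrix m m ℝ} (hA : A.IsHermitian) (v : m → ℝ) :
    lambdaMin A * ‖WithLp.toLp 2 v‖ ^ 2 ≤ v ⬝ᵥ A *ᵥ v := by
  rw [dotProduct_mulVec_eq_sum_eigenvalues hA, ← sum_inner_eigenvectorBasis_sq hA, Finset.mul_sum]
  refine Finset.sum_le_sum fun i _ => mul_le_mul_of_nonneg_right ?_ (sq_nonneg _)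
  rw [lambdaMin, hA.spectrum_real_eq_range_eigenvalues]
  exact csInf_le (Set.finite_range _).bddBelow (mem_range_self i)

lemma le_lambdaMax_mul {A : Matrix m m ℝ} (hA : A.IsHermitian) (v : m → ℝ) :
    v ⬝ᵥ A *ᵥ v ≤ lambdaMax A * ‖WithLp.toLp 2 v‖ ^ 2 := by
  rw [dotProduct_mulVec_eq_sum_eigenvalues hA, ← sum_inner_eigenvectorBasis_sq hA, Finset.mul_sum]
  refine Finset.sum_le_sum fun i _ => mul_le_mul_of_nonneg_right ?_ (sq_nonneg _)
  rw [lambdaMax, hA.spectrum_real_eq_range_eigenvalues]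
  exact le_csSup (Set.finite_range _).bddAbove (mem_range_self i)

lemma lambdaMin_pos [Nonempty m] {A : Matrix m m ℝ} (hA : A.PosDef) : 0 < lambdaMin A := by
  rw [lambdaMin, hA.1.spectrum_real_eq_range_eigenvalues]
  obtain ⟨i, hi⟩ := (range_nonempty hA.1.eigenvalues).csInf_mem (Set.finite_range _)
  rw [← hi]
  exact hA.eigenvalues_pos i

lemma lambdaMax_pos [Nonempty m] {A : Matrix m m ℝ} (hA : A.PosDef) : 0 < lambdaMax A := by
  rw [lambdaMax, hA.1.spectrum_real_eq_range_eigenvalues]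
  obtain ⟨i, hi⟩ := (range_nonempty hA.1.eigenvalues).csSup_mem (Set.finite_range _)
  rw [← hi]
  exact hA.eigenvalues_pos i

/-- On the orthogonal complement of a simple kernel, the quadratic form of a symmetric matrix is
bounded below by the least nonzero eigenvalue. -/
lemma mul_le_dotProduct_mulVec_of_simple_zero {A : Matrix m m ℝ} (hA : A.IsHermitian) {u : m → ℝ}
    (hu : u ≠ 0) (hAu : A *ᵥ u = 0) (hsimple : A.charpoly.rootMultiplicity 0 = 1) {lam : ℝ}
    (hlam : ∀ μ ∈ spectrum ℝ A, μ ≠ 0 → lam ≤ μ) {w : m → ℝ} (hw : u ⬝ᵥ w = 0) :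
    lam * ‖WithLp.toLp 2 w‖ ^ 2 ≤ w ⬝ᵥ A *ᵥ w := by
  set b := hA.eigenvectorBasis
  -- By symmetry the product is `⟪A u, b i⟫`, and `u` lies in the kernel.
  have hmul : ∀ i, hA.eigenvalues i * inner ℝ (b i) (WithLp.toLp 2 u) = 0 := fun i => by
    have h1 : inner ℝ (WithLp.toLp 2 u) (hA.eigenvalues i • b i) = 0 := by
      have h2 : hA.eigenvalues i • b i = Matrix.toEuclideanCLM (n := m) (𝕜 := ℝ) A (b i) := by
        apply WithLp.ofLp_injective 2
        rw [Matrix.ofLp_toEuclideanCLM]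
        exact (hA.mulVec_eigenvectorBasis i).symm
      rw [h2, Matrix.inner_toEuclideanCLM, Matrix.dotProduct_mulVec, ← Matrix.mulVec_transpose]
      have : Aᵀ = A := hA
      rw [this]
      change (A *ᵥ u) ⬝ᵥ _ = 0
      rw [hAu, zero_dotProduct]
    rwa [inner_smul_right, real_inner_comm] at h1
  -- The roots of the characteristic polynomial are the eigenvalues with multiplicity, so exactly
  -- one index `i₀` has eigenvalue zero. Then `u` is a multiple of `b i₀`, and `w` has no component
  -- along it.
  have hcount : (Finset.univ.filter fun i => hA.eigenvalues i = 0).card = 1 := by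
    rw [← hsimple, ← Polynomial.count_roots, hA.roots_charpoly_eq_eigenvalues,
      Multiset.count_map, ← Finset.filter_val, Finset.card_val]
    congr 1
    ext i
    simp [eq_comm]
  obtain ⟨i₀, hi₀⟩ := Finset.card_eq_one.1 hcount
  have hzero : ∀ i, hA.eigenvalues i = 0 ↔ i = i₀ := fun i => by
    have := Finset.ext_iff.1 hi₀ i
    simpa using this
  have hu' : ∀ i, i ≠ i₀ → inner ℝ (b i) (WithLp.toLp 2 u) = 0 := fun i hi =>
    (mul_eq_zero.1 (hmul i)).resolve_left (fun h => hi ((hzero i).1 h))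
  have hrepr : WithLp.toLp 2 u = inner ℝ (b i₀) (WithLp.toLp 2 u) • b i₀ := by
    conv_lhs => rw [← b.sum_repr' (WithLp.toLp 2 u)]
    exact Finset.sum_eq_single i₀ (fun i _ hi => by rw [hu' i hi, zero_smul]) (by simp)
  have hw₀ : inner ℝ (b i₀) (WithLp.toLp 2 w) = 0 := by
    have h1 : inner ℝ (WithLp.toLp 2 u) (WithLp.toLp 2 w) = 0 := by
      rw [EuclideanSpace.inner_eq_star_dotProduct, dotProduct_comm]
      simpa using hw
    rw [hrepr, inner_smul_left] at h1
    refine (mul_eq_zero.1 h1).resolve_left fun h => hu ?_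
    have h0 : WithLp.toLp 2 u = 0 := by
      rw [hrepr]
      rw [RCLike.conj_to_real] at h
      rw [h, zero_smul]
    simpa using h0
  rw [dotProduct_mulVec_eq_sum_eigenvalues hA, ← sum_inner_eigenvectorBasis_sq hA, Finset.mul_sum]
  refine Finset.sum_le_sum fun i _ => ?_
  by_cases hi : i = i₀
  · change lam * inner ℝ (b i) _ ^ 2 ≤ _ * inner ℝ (b i) _ ^ 2
    rw [hi, hw₀]; simp
  · refine mul_le_mul_of_nonneg_right (hlam _ (hA.eigenvalues_mem_spectrum_real i) ?_) (sq_nonneg _)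
    exact fun h => hi ((hzero i).1 h)

end QuadraticForms

/-! ### Entrywise integrals of matrix functions and their quadratic forms. -/

section MatIntegral

lemma intervalIntegrable_sum {ι : Type*} {s : Finset ι} {f : ι → ℝ → ℝ} {a b : ℝ}
    (h : ∀ i ∈ s, IntervalIntegrable (f i) volume a b) :
    IntervalIntegrable (fun t => ∑ i ∈ s, f i t) volume a b := by
  simpa only [Finset.sum_fn] using IntervalIntegrable.sum s h

lemma intervalIntegrable_dotProduct_mulVec {m q : Type*} [Fintype m] [Fintype q]
    {A : ℝ → Matrix m q ℝ} {a b : ℝ}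
    (hA : ∀ i j, IntervalIntegrable (fun s => A s i j) volume a b) (v : m → ℝ) (w : q → ℝ) :
    IntervalIntegrable (fun s => v ⬝ᵥ A s *ᵥ w) volume a b :=
  intervalIntegrable_sum fun i _ =>
    (intervalIntegrable_sum fun j _ => (hA i j).mul_const (w j)).const_mul (v i)

lemma dotProduct_matIntegral_mulVec {m q : Type*} [Fintype m] [Fintype q] {A : ℝ → Matrix m q ℝ}
    {a b : ℝ} (hA : ∀ i j, IntervalIntegrable (fun s => A s i j) volume a b) (v : m → ℝ)
    (w : q → ℝ) : v ⬝ᵥ matIntegral A a b *ᵥ w = ∫ s in a..b, v ⬝ᵥ A s *ᵥ w := by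
  simp only [dotProduct, Matrix.mulVec, matIntegral, Matrix.of_apply]
  rw [intervalIntegral.integral_finsetSum fun i _ =>
    (intervalIntegrable_sum fun j _ => (hA i j).mul_const (w j)).const_mul (v i)]
  refine Finset.sum_congr rfl fun i _ => ?_
  rw [intervalIntegral.integral_const_mul,
    intervalIntegral.integral_finsetSum fun j _ => (hA i j).mul_const (w j)]
  simp only [intervalIntegral.integral_mul_const]

lemma intervalIntegrable_of_measurableEntries {m : Type*} [Fintype m] [DecidableEq m]
    {A : ℝ → Matrix m m ℝ} (hA : MeasurableEntries A) {r : ℝ}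
    (hr : ∀ t, 0 ≤ t → inducedNorm (A t) ≤ r) {a b : ℝ} (ha : 0 ≤ a) (hb : 0 ≤ b) (i j : m) :
    IntervalIntegrable (fun s => A s i j) volume a b := by
  have hsub : uIoc a b ⊆ Ici 0 := fun s hs => (le_min ha hb).trans hs.1.le
  have : IsFiniteMeasure (volume.restrict (uIoc a b)) :=
    isFiniteMeasure_restrict.2 (by simp [uIoc])
  rw [intervalIntegrable_iff]
  refine Integrable.of_bound (C := r)
    ((hA i j).mono_measure (Measure.restrict_mono hsub le_rfl)).aestronglyMeasurable ?_
  refine (ae_restrict_iff' measurableSet_uIoc).2 (.of_forall fun s hs => ?_)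
  exact (abs_apply_le_inducedNorm _ _ _).trans (hr s (hsub hs))

lemma MeasurableEntries.transpose_mul_self {p q : Type*} [Fintype p] {A : ℝ → Matrix p q ℝ}
    (hA : MeasurableEntries A) : MeasurableEntries fun t => (A t)ᵀ * A t := by
  intro i j
  simp only [Matrix.mul_apply, Matrix.transpose_apply]
  exact Finset.aemeasurable_fun_sum _ fun k _ => (hA k i).mul (hA k j)

end MatIntegral

/-! ### Block structure of the network regressor. -/

section Network

variable {n N Ny : ℕ}

lemma blockDiag_mulVec {p q : ℕ} (B : Fin n → Matrix (Fin p) (Fin q) ℝ) (v : Fin n × Fin q → ℝ)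
    (i : Fin n) (k : Fin p) : (blockDiag B *ᵥ v) (i, k) = (B i *ᵥ fun l => v (i, l)) k := by
  simp [Matrix.mulVec, dotProduct, blockDiag, Fintype.sum_prod_type, ite_mul]

lemma dotProduct_blockDiag_mulVec {p q : ℕ} (B : Fin n → Matrix (Fin p) (Fin q) ℝ)
    (v : Fin n × Fin p → ℝ) (w : Fin n × Fin q → ℝ) :
    v ⬝ᵥ blockDiag B *ᵥ w = ∑ i, (fun k => v (i, k)) ⬝ᵥ B i *ᵥ fun l => w (i, l) := by
  simp only [dotProduct, Fintype.sum_prod_type, blockDiag_mulVec]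

lemma blockDiag_transpose_mul_self (C : Fin n → Matrix (Fin Ny) (Fin N) ℝ) :
    (blockDiag C)ᵀ * blockDiag C = blockDiag fun i => (C i)ᵀ * C i := by
  ext ⟨i, k⟩ ⟨j, l⟩
  simp only [Matrix.mul_apply, Matrix.transpose_apply, blockDiag, Matrix.of_apply,
    Fintype.sum_prod_type]
  rw [Finset.sum_eq_single i (fun a _ ha => by simp [ha]) (by simp)]
  by_cases h : i = j <;> simp [h]

lemma blockDiag_posDef {Γ : Fin n → Matrix (Fin N) (Fin N) ℝ} (hΓ : ∀ i, (Γ i).PosDef) :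
    (blockDiag Γ).PosDef := by
  refine Matrix.PosDef.of_dotProduct_mulVec_pos ?_ fun v hv => ?_
  · ext ⟨i, k⟩ ⟨j, l⟩
    simp only [blockDiag, Matrix.conjTranspose_apply, Matrix.of_apply, star_trivial]
    by_cases h : i = j
    · subst h
      simpa using (hΓ i).1.apply k l
    · simp [h, Ne.symm h]
  · rw [star_trivial, dotProduct_blockDiag_mulVec]
    obtain ⟨⟨i, k⟩, hik⟩ := Function.ne_iff.1 hv
    refine Finset.sum_pos' (fun j _ => ?_) ⟨i, Finset.mem_univ _, ?_⟩
    · simpa using (hΓ j).posSemidef.dotProduct_mulVec_nonneg fun k => v (j, k)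
    · simpa using (hΓ i).dotProduct_mulVec_pos (x := fun k => v (i, k))
        (Function.ne_iff.2 ⟨k, hik⟩)

lemma EdgeOrientation.source_ne_sink {G : SimpleGraph (Fin n)} (o : EdgeOrientation G)
    (e : G.edgeSet) : o.source e ≠ o.sink e := by
  have h := e.2
  rw [← o.ends e, SimpleGraph.mem_edgeSet] at h
  exact h.ne

/-- A simple graph has no loops, so each column of `D` has exactly one entry `1` and one entry `-1`,
and `Dᵀ 1 = 0`. -/
lemma laplacian_mulVec_one {G : SimpleGraph (Fin n)} (o : EdgeOrientation G) :
    laplacian o *ᵥ 1 = 0 := by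
  have h : (incidence o)ᵀ *ᵥ (1 : Fin n → ℝ) = 0 := by
    ext e
    have hne := o.source_ne_sink e
    simp only [Matrix.mulVec, dotProduct, Matrix.transpose_apply, incidence, Matrix.of_apply,
      Pi.one_apply, mul_one, Pi.zero_apply]
    have : ∀ i, (if i = o.source e then (1 : ℝ) else if i = o.sink e then -1 else 0) =
        (if i = o.source e then 1 else 0) - (if i = o.sink e then 1 else 0) := by
      intro i
      by_cases h1 : i = o.source e
      · simp [h1, hne]
      · simp only [h1, if_false, zero_sub]
        split_ifs <;> simp
    simp [this]
  rw [laplacian, ← Matrix.mulVec_mulVec, h, Matrix.mulVec_zero]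

lemma transpose_mul_self_posSemidef {p q : Type*} [Fintype p] [Fintype q] (A : Matrix p q ℝ) :
    (Aᵀ * A).PosSemidef := by
  have := Matrix.posSemidef_conjTranspose_mul_self A
  rwa [Matrix.conjTranspose_eq_transpose_of_trivial] at this

/-- The normal matrix `Λ̄ᵀ Λ̄` splits into the local regressors and the network coupling. -/
lemma regressor_transpose_mul_self (C : Fin n → Matrix (Fin Ny) (Fin N) ℝ)
    {G : SimpleGraph (Fin n)} (o : EdgeOrientation G) {α : ℝ} (hα : 0 ≤ α) :
    (regressor C o α)ᵀ * regressor C o α = blockDiag (fun i => (C i)ᵀ * C i) +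
      α • Matrix.kronecker (laplacian o) (1 : Matrix (Fin N) (Fin N) ℝ) := by
  rw [regressor, Matrix.transpose_fromRows, Matrix.fromCols_mul_fromRows,
    blockDiag_transpose_mul_self, Matrix.transpose_smul, Matrix.smul_mul, Matrix.mul_smul, smul_smul,
    Real.mul_self_sqrt hα, laplacian]
  congr 2
  have h := Matrix.mul_kronecker_mul (incidence o) (incidence o)ᵀ (1 : Matrix (Fin N) (Fin N) ℝ)
    (1 : Matrix (Fin N) (Fin N) ℝ)
  rw [mul_one] at h
  have h2 := Matrix.kroneckerMap_transpose (· * ·) (incidence o)ᵀ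
    (1 : Matrix (Fin N) (Fin N) ℝ)
  rw [Matrix.transpose_transpose, Matrix.transpose_one] at h2
  refine Eq.trans ?_ h.symm
  rw [h2]
  rfl

lemma dotProduct_kronecker_one_mulVec (L : Matrix (Fin n) (Fin n) ℝ) (v w : Fin n × Fin N → ℝ) :
    v ⬝ᵥ Matrix.kronecker L (1 : Matrix (Fin N) (Fin N) ℝ) *ᵥ w =
      ∑ k, (fun i => v (i, k)) ⬝ᵥ L *ᵥ fun i => w (i, k) := by
  have h : ∀ i k, (Matrix.kronecker L (1 : Matrix (Fin N) (Fin N) ℝ) *ᵥ w) (i, k) =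
      (L *ᵥ fun i => w (i, k)) i := fun i k => by
    simp [Matrix.mulVec, dotProduct, Fintype.sum_prod_type, Matrix.one_apply]
  simp only [dotProduct, Fintype.sum_prod_type, h]
  exact Finset.sum_comm

/-- The regressors act on the slice of each agent, the Laplacian on the slice of each parameter
coordinate. `norm_toLp_prod_sq` and `norm_toLp_prod_sq'` are the matching decompositions of the
norm. -/
lemma dotProduct_regressor_mulVec (C : Fin n → Matrix (Fin Ny) (Fin N) ℝ)
    {G : SimpleGraph (Fin n)} (o : EdgeOrientation G) {α : ℝ} (hα : 0 ≤ α)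
    (v w : Fin n × Fin N → ℝ) :
    v ⬝ᵥ ((regressor C o α)ᵀ * regressor C o α) *ᵥ w =
      (∑ i, (fun k => v (i, k)) ⬝ᵥ ((C i)ᵀ * C i) *ᵥ fun k => w (i, k)) +
      α * ∑ k, (fun i => v (i, k)) ⬝ᵥ laplacian o *ᵥ fun i => w (i, k) := by
  rw [regressor_transpose_mul_self C o hα, Matrix.add_mulVec, dotProduct_add,
    dotProduct_blockDiag_mulVec, Matrix.smul_mulVec, dotProduct_smul,
    dotProduct_kronecker_one_mulVec, smul_eq_mul]

lemma norm_toLp_prod_sq (v : Fin n × Fin N → ℝ) :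
    ‖WithLp.toLp 2 v‖ ^ 2 = ∑ i, ‖WithLp.toLp 2 fun k => v (i, k)‖ ^ 2 := by
  simp only [norm_toLp_sq, Fintype.sum_prod_type]

lemma norm_toLp_prod_sq' (v : Fin n × Fin N → ℝ) :
    ‖WithLp.toLp 2 v‖ ^ 2 = ∑ k, ‖WithLp.toLp 2 fun i => v (i, k)‖ ^ 2 := by
  simp only [norm_toLp_sq, Fintype.sum_prod_type]
  exact Finset.sum_comm

lemma dotProduct_regressor_mulVec_le (C : Fin n → Matrix (Fin Ny) (Fin N) ℝ)
    {G : SimpleGraph (Fin n)} (o : EdgeOrientation G) {α r2 r3 : ℝ} (hα : 0 ≤ α)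
    (h2 : ∀ i, inducedNorm ((C i)ᵀ * C i) ≤ r2) (h3 : inducedNorm (laplacian o) ≤ r3)
    (v : Fin n × Fin N → ℝ) :
    v ⬝ᵥ ((regressor C o α)ᵀ * regressor C o α) *ᵥ v ≤
      (r2 + α * r3) * ‖WithLp.toLp 2 v‖ ^ 2 := by
  rw [dotProduct_regressor_mulVec C o hα, add_mul, mul_assoc]
  gcongr
  · rw [norm_toLp_prod_sq, Finset.mul_sum]
    exact Finset.sum_le_sum fun i _ => dotProduct_mulVec_le (h2 i) _
  · rw [norm_toLp_prod_sq', Finset.mul_sum]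
    exact Finset.sum_le_sum fun k _ => dotProduct_mulVec_le h3 _

end Network

end CIEstimator

/-! ### Excitation of the network over a window. -/

namespace CIEstimator

open MeasureTheory Set
open scoped Matrix

section Excitation

variable {n N Ny : ℕ}

lemma laplacian_transpose {G : SimpleGraph (Fin n)} (o : EdgeOrientation G) :
    (laplacian o)ᵀ = laplacian o := by
  simp [laplacian, Matrix.transpose_mul]

/-- The Laplacian does not see the consensus component. -/
lemma dotProduct_laplacian_mulVec_sub_const {G : SimpleGraph (Fin n)} (o : EdgeOrientation G)
    (u : Fin n → ℝ) (c : ℝ) :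
    (u - c • 1) ⬝ᵥ laplacian o *ᵥ (u - c • 1) = u ⬝ᵥ laplacian o *ᵥ u := by
  have h1 : (1 : Fin n → ℝ) ⬝ᵥ laplacian o *ᵥ u = 0 := by
    rw [Matrix.dotProduct_mulVec, ← Matrix.mulVec_transpose, laplacian_transpose,
      laplacian_mulVec_one, zero_dotProduct]
  rw [Matrix.mulVec_sub, Matrix.mulVec_smul, laplacian_mulVec_one, smul_zero, sub_zero,
    sub_dotProduct, smul_dotProduct, h1, smul_zero, sub_zero]

/-- Connectedness on average excites the disagreement of scalar states. -/
lemma mul_le_integral_laplacian {G : ℝ → SimpleGraph (Fin n)}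
    {o : (t : ℝ) → EdgeOrientation (G t)} {a b lam : ℝ}
    (hint : ∀ i j, IntervalIntegrable (fun s => laplacian (o s) i j) volume a b)
    (hsimple : (matIntegral (fun s => laplacian (o s)) a b).charpoly.rootMultiplicity 0 = 1)
    (hlam : ∀ μ ∈ spectrum ℝ (matIntegral (fun s => laplacian (o s)) a b), μ ≠ 0 → lam ≤ μ)
    (hn : n ≠ 0) (u : Fin n → ℝ) (c : ℝ) (hc : ∑ i, (u i - c) = 0) :
    lam * ‖WithLp.toLp 2 (u - c • 1)‖ ^ 2 ≤ ∫ s in a..b, u ⬝ᵥ laplacian (o s) *ᵥ u := by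
  set L := matIntegral (fun s => laplacian (o s)) a b with hL
  have hherm : L.IsHermitian := by
    ext i j
    simp only [hL, matIntegral, Matrix.conjTranspose_apply, Matrix.of_apply, star_trivial]
    refine intervalIntegral.integral_congr fun s _ => ?_
    exact congrFun (congrFun (laplacian_transpose (o s)) i) j
  have hone : L *ᵥ 1 = 0 := by
    ext i
    have h := dotProduct_matIntegral_mulVec hint (Pi.single i 1) 1
    simp only [laplacian_mulVec_one, dotProduct_zero, intervalIntegral.integral_zero,
      single_dotProduct, one_mul] at h
    exact h
  have h1 : (1 : Fin n → ℝ) ≠ 0 := by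
    have : Nonempty (Fin n) := ⟨⟨0, Nat.pos_of_ne_zero hn⟩⟩
    exact one_ne_zero
  have h := mul_le_dotProduct_mulVec_of_simple_zero hherm h1 hone hsimple hlam
    (w := u - c • 1) (by simpa [dotProduct] using hc)
  rw [hL, dotProduct_matIntegral_mulVec hint] at h
  simpa only [dotProduct_laplacian_mulVec_sub_const] using h

/-- Lower bound of the regressor part by its value at the consensus component. -/
lemma le_sum_dotProduct_add {S : Fin n → Matrix (Fin N) (Fin N) ℝ} {r : ℝ}
    (hpos : ∀ i, (S i).PosSemidef) (hr : ∀ i, inducedNorm (S i) ≤ r) (c : Fin N → ℝ)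
    (w : Fin n × Fin N → ℝ) :
    c ⬝ᵥ (∑ i, S i) *ᵥ c -
        2 * r * (‖WithLp.toLp 2 c‖ * (Real.sqrt n * ‖WithLp.toLp 2 w‖)) ≤
      ∑ i, (fun k => c k + w (i, k)) ⬝ᵥ S i *ᵥ fun k => c k + w (i, k) := by
  rcases Nat.eq_zero_or_pos n with rfl | hn
  · simp
  have hr0 : 0 ≤ r := (norm_nonneg _).trans (hr ⟨0, hn⟩)
  have hterm : ∀ i, c ⬝ᵥ S i *ᵥ c -
      2 * r * (‖WithLp.toLp 2 c‖ * ‖WithLp.toLp 2 fun k => w (i, k)‖) ≤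
      (fun k => c k + w (i, k)) ⬝ᵥ S i *ᵥ fun k => c k + w (i, k) := by
    intro i
    set z : Fin N → ℝ := fun k => w (i, k)
    change _ ≤ (c + z) ⬝ᵥ S i *ᵥ (c + z)
    -- Of the four terms, the one quadratic in `z` is nonnegative and dropped; each of the two cross
    -- terms costs at most `r ‖c‖ ‖z‖`.
    rw [Matrix.mulVec_add, dotProduct_add, add_dotProduct, add_dotProduct]
    have h1 := abs_le.1 ((abs_dotProduct_mulVec_le (S i) c z).trans
      (mul_le_mul_of_nonneg_right (hr i) (by positivity)))
    have h2 := abs_le.1 ((abs_dotProduct_mulVec_le (S i) z c).trans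
      (mul_le_mul_of_nonneg_right (hr i) (by positivity)))
    have h3 := (hpos i).dotProduct_mulVec_nonneg z
    rw [star_trivial] at h3
    have h4 : ‖WithLp.toLp 2 z‖ * ‖WithLp.toLp 2 c‖ = ‖WithLp.toLp 2 c‖ * ‖WithLp.toLp 2 z‖ :=
      mul_comm _ _
    rw [h4] at h2
    linarith [h1.1, h2.1]
  have hcs : ∑ i, ‖WithLp.toLp 2 fun k => w (i, k)‖ ≤ Real.sqrt n * ‖WithLp.toLp 2 w‖ := by
    refine le_of_sq_le_sq ?_ (by positivity)
    rw [mul_pow, Real.sq_sqrt (by positivity), norm_toLp_prod_sq]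
    have := sq_sum_le_card_mul_sum_sq (s := (Finset.univ : Finset (Fin n)))
      (f := fun i => ‖WithLp.toLp 2 fun k => w (i, k)‖)
    simpa using this
  have hsum : c ⬝ᵥ (∑ i, S i) *ᵥ c = ∑ i, c ⬝ᵥ S i *ᵥ c := by
    rw [Matrix.sum_mulVec, dotProduct_sum]
  refine le_trans ?_ (Finset.sum_le_sum fun i _ => hterm i)
  rw [Finset.sum_sub_distrib, ← hsum, ← Finset.mul_sum, ← Finset.mul_sum]
  gcongr

/-- Pythagoras: a state common to all agents is orthogonal to a disagreement. The common part is
repeated `n` times. -/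
lemma norm_toLp_const_add_sq (c : Fin N → ℝ) (w : Fin n × Fin N → ℝ)
    (hw : ∀ k, ∑ i, w (i, k) = 0) :
    ‖WithLp.toLp 2 fun p : Fin n × Fin N => c p.2 + w p‖ ^ 2 =
      n * ‖WithLp.toLp 2 c‖ ^ 2 + ‖WithLp.toLp 2 w‖ ^ 2 := by
  rw [norm_toLp_prod_sq', norm_toLp_prod_sq']
  simp only [norm_toLp_sq]
  rw [Finset.mul_sum, ← Finset.sum_add_distrib]
  refine Finset.sum_congr rfl fun k _ => ?_
  have : ∀ i, (c k + w (i, k)) ^ 2 = c k ^ 2 + 2 * c k * w (i, k) + w (i, k) ^ 2 := fun i => by ring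
  simp only [this, Finset.sum_add_distrib, ← Finset.mul_sum, hw]
  simp

lemma iota2Lower_nonneg {T α i1lo r2 lam : ℝ} (hα : 0 ≤ α) (hlam : 0 ≤ lam) :
    0 ≤ iota2Lower n N T α i1lo r2 lam := by
  refine Real.sInf_nonneg ?_
  rintro _ ⟨a, ha, rfl⟩
  exact le_max_of_le_left (mul_nonneg (mul_nonneg hα hlam) (sub_nonneg.2 ha))

/-- The number `ι̲₂` bounds from below every quantity that dominates both alternatives at each split
of the squared norm into a consensus and a disagreement part. -/
lemma iota2Lower_mul_le_of_le {T α i1lo r2 lam y z : ℝ} (hα : 0 ≤ α) (hlam : 0 ≤ lam) (hn : n ≠ 0)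
    (c : Fin N → ℝ) {d : ℝ} (hd : 0 ≤ d) (hz : n * ‖WithLp.toLp 2 c‖ ^ 2 + d ^ 2 = z)
    (h1 : α * lam * d ^ 2 ≤ y)
    (h2 : i1lo * ‖WithLp.toLp 2 c‖ ^ 2 -
      2 * r2 * T * (‖WithLp.toLp 2 c‖ * (Real.sqrt n * d)) ≤ y) :
    iota2Lower n N T α i1lo r2 lam * z ≤ y := by
  have hn' : (0 : ℝ) < n := by positivity
  have hz0 : 0 ≤ z := by rw [← hz]; positivity
  rcases hz0.eq_or_lt with hz0 | hz0
  · rw [← hz0, mul_zero]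
    exact le_trans (by positivity) h1
  have hsz : 0 < Real.sqrt z := Real.sqrt_pos.2 hz0
  -- The scaling makes `‖a‖²` the consensus share of the squared norm `z`, so that `1 - ‖a‖²` is the
  -- disagreement share `d² / z`.
  set a : EuclideanSpace ℝ (Fin N) := (Real.sqrt n / Real.sqrt z) • WithLp.toLp 2 c with ha
  have hna : ‖a‖ ^ 2 = n * ‖WithLp.toLp 2 c‖ ^ 2 / z := by
    rw [ha, norm_smul, Real.norm_of_nonneg (by positivity), mul_pow, div_pow, Real.sq_sqrt hn'.le,
      Real.sq_sqrt hz0.le]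
    ring
  have hna' : 1 - ‖a‖ ^ 2 = d ^ 2 / z := by
    rw [hna, eq_div_iff hz0.ne', sub_mul, div_mul_cancel₀ _ hz0.ne']
    linarith
  have hsqrt : Real.sqrt (‖a‖ ^ 2 * (1 - ‖a‖ ^ 2)) =
      ‖WithLp.toLp 2 c‖ * (Real.sqrt n * d) / z := by
    rw [hna', hna, Real.sqrt_eq_iff_mul_self_eq (by positivity) (by positivity)]
    have := Real.sq_sqrt hn'.le
    field_simp
    rw [this]
    ring
  have hle : iota2Lower n N T α i1lo r2 lam ≤ max (α * lam * (1 - ‖a‖ ^ 2))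
      (i1lo / n * ‖a‖ ^ 2 - 2 * r2 * T * Real.sqrt (‖a‖ ^ 2 * (1 - ‖a‖ ^ 2))) := by
    refine csInf_le ⟨0, ?_⟩ ⟨a, ?_, rfl⟩
    · rintro _ ⟨a', ha', rfl⟩
      exact le_max_of_le_left (mul_nonneg (mul_nonneg hα hlam) (sub_nonneg.2 ha'))
    · rw [mem_ofPred_eq, ← sub_nonneg, hna']; positivity
  rw [← le_div_iff₀ hz0]
  refine hle.trans (max_le ?_ ?_)
  · rw [hna', ← mul_div_assoc]
    gcongr
  · rw [hsqrt, hna, show i1lo / n * (n * ‖WithLp.toLp 2 c‖ ^ 2 / z) -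
      2 * r2 * T * (‖WithLp.toLp 2 c‖ * (Real.sqrt n * d) / z) = (i1lo * ‖WithLp.toLp 2 c‖ ^ 2 -
      2 * r2 * T * (‖WithLp.toLp 2 c‖ * (Real.sqrt n * d))) / z by field_simp]
    gcongr

namespace NetworkAssumption

variable {C : ℝ → Fin n → Matrix (Fin Ny) (Fin N) ℝ} {G : ℝ → SimpleGraph (Fin n)}
  {o : (t : ℝ) → EdgeOrientation (G t)} {T i1lo i1hi r2 lam r3 : ℝ}

/-- The characteristic polynomial of an empty matrix is `1`, which has no root. -/
lemma card_ne_zero (h : NetworkAssumption C G o T i1lo i1hi r2 lam r3) : n ≠ 0 := by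
  rintro rfl
  have := h.zero_simple T le_rfl
  simp [Matrix.charpoly, Polynomial.rootMultiplicity_eq_zero] at this

/-- Cooperative excitation of the whole network. -/
lemma iota2Lower_mul_le (h : NetworkAssumption C G o T i1lo i1hi r2 lam r3) {α : ℝ} (hα : 0 < α)
    {t : ℝ} (ht : 0 ≤ t) (v : Fin n × Fin N → ℝ) :
    iota2Lower n N T α i1lo r2 lam * ‖WithLp.toLp 2 v‖ ^ 2 ≤
      ∫ s in t..t + T, v ⬝ᵥ ((regressor (C s) (o s) α)ᵀ * regressor (C s) (o s) α) *ᵥ v := by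
  have hn := h.card_ne_zero
  have hn' : (n : ℝ) ≠ 0 := Nat.cast_ne_zero.2 hn
  have hT := h.T_pos
  have htT : t ≤ t + T := by linarith
  have htT0 : 0 ≤ t + T := by linarith
  have hwin : t + T - T = t := by ring
  have hL := intervalIntegrable_of_measurableEntries h.measurable_laplacian h.laplacian_bound ht htT0
  have hS := fun i => intervalIntegrable_of_measurableEntries
    (h.measurable_regressor i).transpose_mul_self (fun s hs => h.regressor_bound s hs i) ht htT0
  -- `c` is the average over the agents and `w` the disagreement.
  set c : Fin N → ℝ := fun k => (∑ i, v (i, k)) / n with hc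
  set w : Fin n × Fin N → ℝ := fun p => v p - c p.2 with hw
  have hvw : v = fun p : Fin n × Fin N => c p.2 + w p := by funext p; simp [hw]
  have hw0 : ∀ k, ∑ i, w (i, k) = 0 := fun k => by
    simp only [hw, hc, Finset.sum_sub_distrib, Finset.sum_const, Finset.card_univ, Fintype.card_fin,
      nsmul_eq_mul]
    field_simp
    ring
  have hnorm : n * ‖WithLp.toLp 2 c‖ ^ 2 + ‖WithLp.toLp 2 w‖ ^ 2 = ‖WithLp.toLp 2 v‖ ^ 2 := by
    rw [← norm_toLp_const_add_sq c w hw0, ← hvw]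
  have hLint := fun k => intervalIntegrable_dotProduct_mulVec hL (fun i => v (i, k)) fun i => v (i, k)
  have hSint := fun i =>
    intervalIntegrable_dotProduct_mulVec (hS i) (fun k => v (i, k)) fun k => v (i, k)
  simp only [dotProduct_regressor_mulVec _ _ hα.le]
  rw [intervalIntegral.integral_add (intervalIntegrable_sum fun i _ => hSint i)
    ((intervalIntegrable_sum fun k _ => hLint k).const_mul α), intervalIntegral.integral_const_mul]
  have hlap : α * lam * ‖WithLp.toLp 2 w‖ ^ 2 ≤ α * ∫ s in t..t + T,
      ∑ k, (fun i => v (i, k)) ⬝ᵥ laplacian (o s) *ᵥ fun i => v (i, k) := by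
    rw [mul_assoc, intervalIntegral.integral_finsetSum fun k _ => hLint k, norm_toLp_prod_sq',
      Finset.mul_sum]
    gcongr with k
    have hs := h.zero_simple (t + T) (by linarith)
    have hl := h.lam_le (t + T) (by linarith)
    rw [hwin] at hs hl
    have := mul_le_integral_laplacian hL hs hl hn (fun i => v (i, k)) (c k) (hw0 k)
    have hwk : (fun i => w (i, k)) = (fun i => v (i, k)) - c k • 1 := by
      ext i
      simp [hw]
    rwa [hwk]
  have hreg : i1lo * ‖WithLp.toLp 2 c‖ ^ 2 -
      2 * r2 * T * (‖WithLp.toLp 2 c‖ * (Real.sqrt n * ‖WithLp.toLp 2 w‖)) ≤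
      ∫ s in t..t + T, ∑ i, (fun k => v (i, k)) ⬝ᵥ ((C s i)ᵀ * C s i) *ᵥ fun k => v (i, k) := by
    have hSsum : ∀ k l, IntervalIntegrable (fun s => (∑ i, (C s i)ᵀ * C s i) k l) volume t (t + T) :=
      fun k l => by
        simp only [Matrix.sum_apply]
        exact intervalIntegrable_sum fun i _ => hS i k l
    have hex := (h.le_excitation (t + T) (by linarith)).dotProduct_mulVec_nonneg c
    rw [hwin, star_trivial, Matrix.sub_mulVec, dotProduct_sub, Matrix.smul_mulVec,
      Matrix.one_mulVec, dotProduct_smul, dotProduct_matIntegral_mulVec hSsum, smul_eq_mul] at hex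
    have hcc : c ⬝ᵥ c = ‖WithLp.toLp 2 c‖ ^ 2 := by
      rw [norm_toLp_sq, dotProduct]
      exact Finset.sum_congr rfl fun k _ => (sq _).symm
    rw [hcc] at hex
    set K := 2 * r2 * (‖WithLp.toLp 2 c‖ * (Real.sqrt n * ‖WithLp.toLp 2 w‖)) with hK
    have hcint := intervalIntegrable_dotProduct_mulVec hSsum c c
    have hle : ∫ s in t..t + T, (c ⬝ᵥ (∑ i, (C s i)ᵀ * C s i) *ᵥ c - K) ≤
        ∫ s in t..t + T, ∑ i, (fun k => v (i, k)) ⬝ᵥ ((C s i)ᵀ * C s i) *ᵥ fun k => v (i, k) := by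
      refine intervalIntegral.integral_mono_on htT (hcint.sub (by simp))
        (intervalIntegrable_sum fun i _ => hSint i) fun s hs => ?_
      have := le_sum_dotProduct_add (fun i => transpose_mul_self_posSemidef (C s i))
        (fun i => h.regressor_bound s (ht.trans hs.1) i) c w
      rw [hvw]
      exact this
    rw [intervalIntegral.integral_sub hcint (by simp), intervalIntegral.integral_const,
      add_sub_cancel_left, smul_eq_mul] at hle
    have : T * K = 2 * r2 * T * (‖WithLp.toLp 2 c‖ * (Real.sqrt n * ‖WithLp.toLp 2 w‖)) := by
      rw [hK]; ring
    linarith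
  -- Both summands of the integral are nonnegative, so their sum dominates the lower bound of each.
  -- This is why a maximum appears in `ι̲₂`.
  have hlap0 : 0 ≤ α * lam * ‖WithLp.toLp 2 w‖ ^ 2 := by
    have := h.lam_pos
    positivity
  have hreg0 : 0 ≤ ∫ s in t..t + T,
      ∑ i, (fun k => v (i, k)) ⬝ᵥ ((C s i)ᵀ * C s i) *ᵥ fun k => v (i, k) :=
    intervalIntegral.integral_nonneg htT fun s _ => Finset.sum_nonneg fun i _ => by
      simpa using (transpose_mul_self_posSemidef (C s i)).dotProduct_mulVec_nonneg fun k => v (i, k)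
  exact iota2Lower_mul_le_of_le hα.le h.lam_pos.le hn c (norm_nonneg _) hnorm (by linarith)
    (by linarith)

end NetworkAssumption

end Excitation

end CIEstimator

/-! ### The error system as a gradient flow, and the conclusion. -/

namespace CIEstimator

open MeasureTheory Set
open scoped Matrix

section ErrorSystem

lemma isPositive_toEuclideanCLM {m : Type*} [Fintype m] [DecidableEq m] {A : Matrix m m ℝ}
    (hA : A.PosSemidef) : (Matrix.toEuclideanCLM (n := m) (𝕜 := ℝ) A).IsPositive := by
  rw [← ContinuousLinearMap.isPositive_toLinearMap_iff, Matrix.coe_toEuclideanCLM_eq_toEuclideanLin]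
  exact Matrix.isPositive_toEuclideanLin_iff.2 hA

lemma aestronglyMeasurable_toEuclideanCLM {m : Type*} [Fintype m] [DecidableEq m]
    {A : ℝ → Matrix m m ℝ} (hA : MeasurableEntries A) :
    AEStronglyMeasurable (fun s => Matrix.toEuclideanCLM (n := m) (𝕜 := ℝ) (A s))
      (volume.restrict (Ici 0)) := by
  have h : (fun s => Matrix.toEuclideanCLM (n := m) (𝕜 := ℝ) (A s)) = fun s =>
      ∑ i, ∑ j, A s i j • Matrix.toEuclideanCLM (n := m) (𝕜 := ℝ) (Matrix.single i j 1) := by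
    funext s
    conv_lhs => rw [Matrix.matrix_eq_sum_single (A s)]
    simp only [map_sum, ← map_smul, Matrix.smul_single, smul_eq_mul, mul_one]
  rw [h]
  exact Finset.aestronglyMeasurable_fun_sum _ fun i _ =>
    Finset.aestronglyMeasurable_fun_sum _ fun j _ => (hA i j).aestronglyMeasurable.smul_const _

lemma inner_toEuclideanCLM_left {m : Type*} [Fintype m] [DecidableEq m] (A : Matrix m m ℝ)
    (v : EuclideanSpace ℝ m) :
    inner ℝ (Matrix.toEuclideanCLM (n := m) (𝕜 := ℝ) A v) v = v.ofLp ⬝ᵥ A *ᵥ v.ofLp := by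
  rw [real_inner_comm, Matrix.inner_toEuclideanCLM]

variable {n N Ny : ℕ} {C : ℝ → Fin n → Matrix (Fin Ny) (Fin N) ℝ} {G : ℝ → SimpleGraph (Fin n)}
  {o : (t : ℝ) → EdgeOrientation (G t)} {T i1lo i1hi r2 lam r3 : ℝ}

/-- The edge set, and with it the shape of `Λ̄`, changes with time. Only the product `Λ̄ᵀΛ̄` has a
fixed index type, and it depends on the graph through the Laplacian alone. -/
lemma NetworkAssumption.measurableEntries_regressor
    (h : NetworkAssumption C G o T i1lo i1hi r2 lam r3) {α : ℝ} (hα : 0 ≤ α) :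
    MeasurableEntries fun s => (regressor (C s) (o s) α)ᵀ * regressor (C s) (o s) α := by
  rintro ⟨i, k⟩ ⟨j, l⟩
  simp only [regressor_transpose_mul_self _ _ hα, Matrix.add_apply, Matrix.smul_apply, smul_eq_mul,
    Matrix.kronecker, Matrix.kroneckerMap_apply, blockDiag, Matrix.of_apply]
  refine AEMeasurable.add ?_ (((h.measurable_laplacian i j).mul_const _).const_mul _)
  by_cases hij : i = j
  · simp only [hij, if_true]
    exact (h.measurable_regressor j).transpose_mul_self k l
  · simp only [hij, if_false]
    exact aemeasurable_const

/-- The error system is a gradient flow. -/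
lemma IsErrorTrajectory.isGradientFlow {Γ : Fin n → Matrix (Fin N) (Fin N) ℝ} {α t₀ : ℝ}
    {x : ℝ → EuclideanSpace ℝ (Fin n × Fin N)} (hx : IsErrorTrajectory C G o Γ α t₀ x)
    (h : NetworkAssumption C G o T i1lo i1hi r2 lam r3) (hα : 0 < α) (ht₀ : 0 ≤ t₀) :
    IsGradientFlow (fun s => Matrix.toEuclideanCLM (n := Fin n × Fin N) (𝕜 := ℝ)
      ((regressor (C s) (o s) α)ᵀ * regressor (C s) (o s) α))
      (Matrix.toEuclideanCLM (n := Fin n × Fin N) (𝕜 := ℝ) (blockDiag Γ)) (r2 + α * r3) t₀ x := by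
  have h2 := h.r2_pos
  have h3 := h.r3_pos
  -- The zero trajectory is a flow of the same operators. It gives access to the integrability
  -- lemmas, which are needed to assemble the coordinate equations of `x` into a vector equation.
  have h0 : IsGradientFlow (fun s => Matrix.toEuclideanCLM (n := Fin n × Fin N) (𝕜 := ℝ)
      ((regressor (C s) (o s) α)ᵀ * regressor (C s) (o s) α))
      (Matrix.toEuclideanCLM (n := Fin n × Fin N) (𝕜 := ℝ) (blockDiag Γ)) (r2 + α * r3) t₀
      (fun _ => 0) :=
    { r_pos := by positivity
      meas := (aestronglyMeasurable_toEuclideanCLM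
        (h.measurableEntries_regressor hα.le)).mono_measure
        (Measure.restrict_mono (Ici_subset_Ici.2 ht₀) le_rfl)
      pos := fun s _ => isPositive_toEuclideanCLM (transpose_mul_self_posSemidef _)
      bound := fun s hs v => by
        rw [inner_toEuclideanCLM_left]
        exact dotProduct_regressor_mulVec_le (C s) (o s) hα.le (h.regressor_bound s (ht₀.trans hs))
          (h.laplacian_bound s (ht₀.trans hs)) v.ofLp
      cont := continuousOn_const
      eq := fun t _ => by simp }
  refine ⟨h0.r_pos, h0.meas, h0.pos, h0.bound, hx.1, fun t ht => ?_⟩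
  have hint := h0.intervalIntegrable_apply hx.1 le_rfl ht
  have hint' : IntervalIntegrable (fun s => -(Matrix.toEuclideanCLM (n := Fin n × Fin N) (𝕜 := ℝ)
      (blockDiag Γ) (Matrix.toEuclideanCLM (n := Fin n × Fin N) (𝕜 := ℝ)
      ((regressor (C s) (o s) α)ᵀ * regressor (C s) (o s) α) (x s)))) volume t₀ t := by
    rw [intervalIntegrable_iff] at hint ⊢
    exact (ContinuousLinearMap.integrable_comp _ hint).neg
  ext k
  rw [hx.2 t ht k, PiLp.add_apply]
  congr 1
  have := (EuclideanSpace.proj k : EuclideanSpace ℝ (Fin n × Fin N) →L[ℝ] ℝ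
    ).intervalIntegral_comp_comm hint'
  refine Eq.trans ?_ this
  refine intervalIntegral.integral_congr fun s _ => ?_
  simp only [PiLp.proj_apply, PiLp.neg_apply, Matrix.ofLp_toEuclideanCLM,
    Matrix.mulVec_mulVec, Matrix.neg_mulVec, Pi.neg_apply, Matrix.mul_assoc]

end ErrorSystem

end CIEstimator

theorem corollary1 {n N Ny : ℕ}
    (C : ℝ → Fin n → Matrix (Fin Ny) (Fin N) ℝ)
    (G : ℝ → SimpleGraph (Fin n)) (o : (t : ℝ) → CIEstimator.EdgeOrientation (G t))
    (Γ : Fin n → Matrix (Fin N) (Fin N) ℝ) (α T i1lo i1hi r2 lam r3 : ℝ)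
    (hgain : CIEstimator.GainAssumption Γ α)
    (hnet : CIEstimator.NetworkAssumption C G o T i1lo i1hi r2 lam r3)
    (r1 i2lo i2hi i3lo i3hi κ₁ κ₂ : ℝ)
    (hr1 : r1 = CIEstimator.inducedNorm (CIEstimator.blockDiag Γ))
    (hi2lo : i2lo = CIEstimator.iota2Lower n N T α i1lo r2 lam)
    (hi2hi : i2hi = CIEstimator.iota2Upper T α r2 r3)
    (hi3lo : i3lo = CIEstimator.iota3Lower r1 i2lo i2hi)
    (hi3hi : i3hi = CIEstimator.iota3Upper r1 i2lo i2hi)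
    (hκ₁ : κ₁ = CIEstimator.kappa1 T Γ i3hi)
    (hκ₂ : κ₂ = CIEstimator.kappa2 T Γ)
    (t₀ : ℝ) (ht₀ : 0 ≤ t₀) (x : ℝ → EuclideanSpace ℝ (Fin n × Fin N))
    (hx : CIEstimator.IsErrorTrajectory C G o Γ α t₀ x) :
    ∀ t, t₀ ≤ t →
      ‖x t‖ ≤ Real.sqrt (κ₁ / κ₂) * ‖x t₀‖ * Real.exp (-(i3lo / (2 * κ₁)) * (t - t₀)) := by
  intro t ht
  -- In dimension zero the spectrum is empty and the extreme eigenvalues are not positive, but every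
  -- state vanishes.
  rcases isEmpty_or_nonempty (Fin n × Fin N) with hemp | hne
  · have hzero : ∀ s, x s = 0 := fun s => Subsingleton.elim _ _
    simp [hzero]
  have hflow := hx.isGradientFlow hnet hgain.alpha_pos ht₀
  have hpd := CIEstimator.blockDiag_posDef hgain.posDef
  have hinv := hpd.inv
  have hT := hnet.T_pos
  have hinvmul : (CIEstimator.blockDiag Γ)⁻¹ * CIEstimator.blockDiag Γ = 1 :=
    Matrix.nonsing_inv_mul _ ((Matrix.isUnit_iff_isUnit_det _).1 hpd.isUnit)
  have hPΓ : ∀ v, Matrix.toEuclideanCLM (n := Fin n × Fin N) (𝕜 := ℝ) (CIEstimator.blockDiag Γ)⁻¹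
      (Matrix.toEuclideanCLM (n := Fin n × Fin N) (𝕜 := ℝ) (CIEstimator.blockDiag Γ) v) = v := by
    intro v
    apply WithLp.ofLp_injective 2
    rw [Matrix.ofLp_toEuclideanCLM, Matrix.ofLp_toEuclideanCLM, Matrix.mulVec_mulVec, hinvmul,
      Matrix.one_mulVec]
  have hP := (CIEstimator.isPositive_toEuclideanCLM hinv.posSemidef).inner_left_eq_inner_right
  have hΓ : 0 < ‖Matrix.toEuclideanCLM (n := Fin n × Fin N) (𝕜 := ℝ) (CIEstimator.blockDiag Γ)‖ := by
    rw [norm_pos_iff]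
    intro h0
    obtain ⟨v, hv⟩ := exists_ne (0 : EuclideanSpace ℝ (Fin n × Fin N))
    refine hv ?_
    rw [← hPΓ v, h0]
    simp
  have hobs : ∀ s, t₀ ≤ s → ∀ v : EuclideanSpace ℝ (Fin n × Fin N),
      i2lo * ‖v‖ ^ 2 ≤ ∫ u in s..s + T, inner ℝ (Matrix.toEuclideanCLM (n := Fin n × Fin N) (𝕜 := ℝ)
        ((CIEstimator.regressor (C u) (o u) α).transpose *
          CIEstimator.regressor (C u) (o u) α) v) v := by
    intro s hs v
    simp only [CIEstimator.inner_toEuclideanCLM_left]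
    rw [hi2lo]
    exact hnet.iota2Lower_mul_le hgain.alpha_pos (ht₀.trans hs) v.ofLp
  -- The lower and the upper bound of the same window integral are compared at a nonzero vector.
  have hab : i2lo ≤ T * (r2 + α * r3) := by
    obtain ⟨v, hv⟩ := exists_ne (0 : EuclideanSpace ℝ (Fin n × Fin N))
    have hv2 : 0 < ‖v‖ ^ 2 := by have := norm_pos_iff.2 hv; positivity
    refine le_of_mul_le_mul_right ((hobs t₀ le_rfl v).trans ?_) hv2
    calc _ ≤ ∫ _ in t₀..t₀ + T, (r2 + α * r3) * ‖v‖ ^ 2 :=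
          intervalIntegral.integral_mono_on (by linarith)
            (hflow.intervalIntegrable_inner continuousOn_const continuousOn_const le_rfl
              (by linarith)) (by simp) fun u hu => hflow.bound u hu.1 v
      _ = _ := by rw [intervalIntegral.integral_const, add_sub_cancel_left, smul_eq_mul, mul_assoc]
  have ha : 0 ≤ i2lo := by
    rw [hi2lo]
    exact CIEstimator.iota2Lower_nonneg hgain.alpha_pos.le hnet.lam_pos.le
  have hmain := hflow.norm_le hP hPΓ hΓ hT (CIEstimator.lambdaMin_pos hinv)
    (CIEstimator.lambdaMax_pos hinv)
    (fun v => by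
      rw [CIEstimator.inner_toEuclideanCLM_left]
      exact CIEstimator.lambdaMin_mul_le hinv.1 v.ofLp)
    (fun v => by
      rw [CIEstimator.inner_toEuclideanCLM_left]
      exact CIEstimator.le_lambdaMax_mul hinv.1 v.ofLp) ha hab hobs rfl rfl ht
  subst hκ₁ hκ₂ hi3hi hi3lo hi2hi hr1
  exact hmain
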